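/- Theorem 8. Let $T\ge 3$ and $e\in\mathbb R$ be fixed. For each $N$ consider the panel AR(1) model $y_{i,t}=\rho y_{i,t-1}+(1-\rho)\mu_i+\varepsilon_{i,t}$, $i=1,\dots,N$, $t=2,\dots,T$, in the worst-case setting: the true value of $\rho$ is $1$; the vectors $(y_{i,1},\dots,y_{i,T})$ are i.i.d. over $i$ and normal; the errors $\varepsilon_{i,t}$ are independent over $i$ and $t$ with law $N(0,\sigma^2)$, $\sigma^2>0$; and $1/\mathrm{Var}(y_{i,1})=o(N^{-1})$. Let $\Delta y_i=(y_{i,2}-y_{i,1},\dots,y_{i,T}-y_{i,T-1})'$, let $D_r$ be the $(T-1)\times(T-1)$ matrix with ones on the diagonal, $-r$ on the first subdiagonal and zeros elsewhere, let $G=D_1D_1'$, $p=\frac12T(T-1)-2$, and let $P=(0\ \ g\ \ I_p)$, where $(1,-1,g')'=\mathrm{vech}(G)$. Put $$m_i(r)=P\,\mathrm{vech}\bigl(D_r\Delta y_i(\Delta y_i)'D_r'\bigr),\qquad m(r)=N^{-1}\sum_{i=1}^N m_i(r),$$ and let $\widehat V(r)$ be the (centered or uncentered) Eicker-White estimator $N^{-1}\sum_i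 (m_i(r)-\bar m)(m_i(r)-\bar m)'$ with $\bar m=m(r)$ or $\bar m=0$, respectively. For $w\in\mathbb R^p\setminus\{0\}$, the GMM-AR statistic for $H_0:\rho=r$ that uses the single linear combination $w'm(r)$ is $AR_w(r)=N(w'm(r))^2/(w'\widehat V(r)w)$. Consider $H_0:\rho=r_N$ with $r_N=1-e/N^{1/4}$. Let $D_u$ be the duplication matrix ($\mathrm{vec}(A)=D_u\mathrm{vech}(A)$ for symmetric $A$), $D_u^+=(D_u'D_u)^{-1}D_u'$, $R=2PD_u^+(G\otimes G)(D_u^+)'P'$, $c_1=P\,\mathrm{vech}(\mathrm{diag}(1,e^2,\dots,e^2))$ and $$\delta=e^4\,\frac{(2T-3)T(T-1)(T-2)}{72}.$$ Write $\chi^2(\lambda,1)$ for the law of $Z^2$ with $Z\sim N(\sqrt\lambda,1)$. Then, as $N\to\infty$: (i) for every $w\neq0$, $w'Rw>0$ and $AR_w(r_N)$ converges in distribution to $\chi^2(\delta_w,1)$ with $\delta_w=(c_1'w)^2/(w'Rw)$; (ii) $\delta$ is the largest root $\lambda$ of the generalized eigenvalue problem $|\lambda R-c_1c_1'|=0$;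 (iii) $\delta$ is the maximum of $\delta_w$ over $w$ with $w'w=1$, and, for $w\ne0$, $\delta_w=\delta$ if and only if $c_1c_1'w=\delta Rw$; (iv) the maximal attainable power curve for testing $H_0$ is that of $\chi^2(\delta,1)$: for every level $\alpha\in(0,1)$, with $q$ the critical value determined by $\Pr(\chi^2(0,1)>q)=\alpha$, the largest limiting rejection probability $\lim_N\Pr(AR_w(r_N)>q)$ over all $w$ with $w'w=1$ exists and equals $\Pr(\chi^2(\delta,1)>q)$, and it is attained by every $w\neq 0$ with $c_1c_1'w=\delta Rw$. -/

import Mathlib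

open MeasureTheory ProbabilityTheory Filter Topology Matrix

noncomputable section

namespace PanelAR

/-! ### Half-vectorization and the duplication matrix -/

/-- Positions of the entries of `vech A`, for `A` an `n × n` matrix: row `q.1.1`, column `q.1.2`,
on or below the diagonal. -/
abbrev VechIdx (n : ℕ) : Type := {q : Fin n × Fin n // q.2 ≤ q.1}

/-- The positions of `vech A` other than the first two, which are (in numbering from 1) the entries
`(1,1)` and `(2,1)` of `A`. -/
abbrev MomIdx (n : ℕ) : Type := {q : VechIdx n // ¬ (q.1.2.val = 0 ∧ q.1.1.val ≤ 1)}

/-- `vech A`: the entries of `A` on and below the diagonal. -/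
def vech {n : ℕ} (A : Matrix (Fin n) (Fin n) ℝ) : VechIdx n → ℝ := fun q => A q.1.1 q.1.2

/-- The duplication matrix: `vec A = dup n *ᵥ vech A` for every symmetric `A`. -/
def dup (n : ℕ) : Matrix (Fin n × Fin n) (VechIdx n) ℝ :=
  Matrix.of fun ij q => if q.1 = (max ij.1 ij.2, min ij.1 ij.2) then 1 else 0

/-- The Moore-Penrose inverse `(Dᵤ' Dᵤ)⁻¹ Dᵤ'` of the duplication matrix. -/
def dupPinv (n : ℕ) : Matrix (VechIdx n) (Fin n × Fin n) ℝ :=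
  ((dup n)ᵀ * dup n)⁻¹ * (dup n)ᵀ

/-! ### The moment conditions -/

/-- The band matrix `D_r`: ones on the diagonal and `-r` just below it. -/
def quasiDiff (n : ℕ) (r : ℝ) : Matrix (Fin n) (Fin n) ℝ :=
  Matrix.of fun i j => if i = j then 1 else if i.val = j.val + 1 then -r else 0

/-- `G = D₁ D₁'`. -/
def gramG (n : ℕ) : Matrix (Fin n) (Fin n) ℝ := quasiDiff n 1 * (quasiDiff n 1)ᵀ

/-- The matrix `P = (0 g I)`, where `(1, -1, g')' = vech (D₁ D₁')`. -/
def selP (n : ℕ) : Matrix (MomIdx n) (VechIdx n) ℝ :=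
  Matrix.of fun q v =>
    if v = q.1 then 1
    else if v.1.1.val = 1 ∧ v.1.2.val = 0 then vech (gramG n) q.1
    else 0

/-- The vector of first differences `(y₂ - y₁, …, y_T - y_{T-1})`. -/
def firstDiff (T : ℕ) (y : ℕ → ℝ) : Fin (T - 1) → ℝ :=
  fun j => y (j.val + 2) - y (j.val + 1)

/-- The contribution `P vech (D_r d d' D_r')` of one individual, with vector of first
differences `d`, to the sample moments. -/
def momentVec {n : ℕ} (r : ℝ) (d : Fin n → ℝ) : MomIdx n → ℝ :=
  selP n *ᵥ vech (quasiDiff n r * Matrix.vecMulVec d d * (quasiDiff n r)ᵀ)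

/-- The sample moments `m(r)`. -/
def sampleMoment {n N : ℕ} (r : ℝ) (d : Fin N → Fin n → ℝ) : MomIdx n → ℝ :=
  (N : ℝ)⁻¹ • ∑ i, momentVec r (d i)

/-- The Eicker-White covariance matrix estimator, centered or not. -/
def eickerWhite {n N : ℕ} (centered : Bool) (r : ℝ) (d : Fin N → Fin n → ℝ) :
    Matrix (MomIdx n) (MomIdx n) ℝ :=
  let c : MomIdx n → ℝ := if centered then sampleMoment r d else 0
  (N : ℝ)⁻¹ • ∑ i, Matrix.vecMulVec (momentVec r (d i) - c) (momentVec r (d i) - c)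

/-- The GMM Anderson-Rubin statistic for the hypothesis `ρ = r` that uses the single linear
combination `w' m(r)` of the moment conditions. -/
def gmmAR {n N : ℕ} (centered : Bool) (w : MomIdx n → ℝ) (r : ℝ) (d : Fin N → Fin n → ℝ) : ℝ :=
  N * (w ⬝ᵥ sampleMoment r d) ^ 2 / (w ⬝ᵥ (eickerWhite centered r d *ᵥ w))

/-- The hypothesized value `1 - e / N^{1/4}`. -/
def nullValue (e : ℝ) (N : ℕ) : ℝ := 1 - e / (N : ℝ) ^ (1 / 4 : ℝ)

/-! ### The noncentral chi-squared distribution with one degree of freedom -/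

/-- `χ²(δ, 1)`: the law of `Z²` with `Z ∼ N(√δ, 1)`. -/
def chiSqOne (δ : ℝ) : Measure ℝ := (gaussianReal (Real.sqrt δ) 1).map (fun x => x ^ 2)

instance (δ : ℝ) : IsProbabilityMeasure (chiSqOne δ) :=
  Measure.isProbabilityMeasure_map (by fun_prop)

/-! ### The limiting eigenvalue problem -/

/-- `2 P Dᵤ⁺ (G ⊗ G) Dᵤ⁺' P'`. -/
def momentCov (n : ℕ) : Matrix (MomIdx n) (MomIdx n) ℝ :=
  (2 : ℝ) • (selP n * dupPinv n * Matrix.kronecker (gramG n) (gramG n) * (dupPinv n)ᵀ * (selP n)ᵀ)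

/-- `c₁ = P vech (diag (1, e², …, e²))`. -/
def drift (n : ℕ) (e : ℝ) : MomIdx n → ℝ :=
  selP n *ᵥ vech (Matrix.diagonal fun i : Fin n => if i.val = 0 then 1 else e ^ 2)

/-- `δ_w = c₁' w (w' (2 P Dᵤ⁺ (G ⊗ G) Dᵤ⁺' P') w)⁻¹ w' c₁`. -/
def noncentrality (n : ℕ) (e : ℝ) (w : MomIdx n → ℝ) : ℝ :=
  (drift n e ⬝ᵥ w) * (w ⬝ᵥ (momentCov n *ᵥ w))⁻¹ * (w ⬝ᵥ drift n e)

/-! ### The panel AR(1) model and the worst-case design -/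

/-- `y_{i,t} = ρ y_{i,t-1} + (1 - ρ) μ_i + ε_{i,t}` for `t = 2, …, T`. -/
def PanelAR1 {Ω : Type*} {N : ℕ} (T : ℕ) (ρ : ℝ) (μ : Fin N → Ω → ℝ)
    (ε y : Fin N → ℕ → Ω → ℝ) : Prop :=
  ∀ i t, 2 ≤ t → t ≤ T → ∀ ω, y i t ω = ρ * y i (t - 1) ω + (1 - ρ) * μ i ω + ε i t ω

/-- The worst-case design, as a triangular array indexed by the number `N` of individuals. -/
structure WorstCaseDesign (T : ℕ) (σ : ℝ) {Ω : ℕ → Type*} [∀ N, MeasurableSpace (Ω N)]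
    (P : ∀ N, Measure (Ω N)) (μ : ∀ N, Fin N → Ω N → ℝ)
    (ε y : ∀ N, Fin N → ℕ → Ω N → ℝ) : Prop where
  sigma_pos : 0 < σ
  /-- The true value of `ρ` is one. -/
  model : ∀ N, PanelAR1 T 1 (μ N) (ε N) (y N)
  /-- The data are independent over individuals, -/
  indep : ∀ N, iIndepFun (fun i ω (t : Fin T) => y N i (t.val + 1) ω) (P N)
  /-- identically distributed -/
  ident : ∀ N i j, IdentDistrib (fun ω (t : Fin T) => y N i (t.val + 1) ω)
    (fun ω (t : Fin T) => y N j (t.val + 1) ω) (P N) (P N)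
  /-- and normal. -/
  normal : ∀ N i, HasGaussianLaw (fun ω (t : Fin T) => y N i (t.val + 1) ω) (P N)
  /-- The errors are independent over time and individuals, -/
  errors_indep : ∀ N, iIndepFun
    (fun (q : Fin N × Fin (T - 1)) ω => ε N q.1 (q.2.val + 2) ω) (P N)
  /-- and homoskedastic `N(0, σ²)`. -/
  errors_law : ∀ N i t, 2 ≤ t → t ≤ T →
    HasLaw (ε N i t) (gaussianReal 0 (Real.toNNReal (σ ^ 2))) (P N)
  /-- `1 / Var(y_{i,1}) = o(1 / N)`. -/
  initial_variance : ∃ v : ℕ → ℝ, (∀ N i, variance (y N i 1) (P N) = v N) ∧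
    Tendsto (fun N : ℕ => v N / (N : ℝ)) atTop atTop

end PanelAR

end

/-!
Write `n = T - 1` and `D = D₁`. The idea is to replace vectors of weights by matrices. For symmetric
`A`, the functional `A ↦ w' P vech A` is `A ↦ tr (W A)` for one symmetric matrix `W = weightMat w`,
and the two linear relations built into `P` say exactly that `tr (W G) = 0` and `tr (W e₁e₁') = 0`;
conversely every symmetric `W` with these two properties arises (`exists_weightMat_eq`). In this
language `w' R w = 2 tr (W G W G) = 2 tr ((D' W D)²)`, which is positive for `w ≠ 0` because `D` is
invertible, and `w' c₁ = e² tr W`.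

**Limit law.** At a unit root the differences `Δyᵢ` are the errors, so the initial observation
does not enter and the statistic is a function of i.i.d. vectors `d` of independent `N(0, σ²)`
variables. With `r = 1 - a` one has `D_r = (1 - a) D + a I`, and therefore
`w' mᵢ(r) = (1 - a)² d' D' W D d + (1 - a) a d' (D' W + W D) d + a² d' W d`.
The first form has mean zero since `tr (W G) = 0`, and variance `σ⁴ w' R w` by Isserlis' formula;
the second has mean zero since `D + D' = G + e₁e₁'`; the third has mean `σ² tr W`. With
`a = e N^{-1/4}`, the central limit theorem and Slutsky's lemma show that `√N w' m(r)` tends to a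
normal variable with mean `e² σ² tr W = σ² w' c₁` and variance `σ⁴ w' R w`, and the law of large
numbers shows that `w' V̂ w` tends to `σ⁴ w' R w`
(`tendstoInDistribution_arRatio`). The limit theorems are proved on one fixed space of i.i.d.
sequences and transferred to the triangular array by equality of laws.

**Optimal combination.** If `c₁ = R v`, the Cauchy-Schwarz inequality for the form `R` gives
`δ_w ≤ v' R v`, with equality exactly for `c₁ c₁' w = (v' R v) R w`; the same inequality bounds the
roots of `|λ R - c₁ c₁'|`. Congruence by `D` maps the identity to `G`, the matrix `J` of ones to
`e₁e₁'`, and the matrix `M = (min (i, j))`, with indices from zero, to `I - e₁e₁'`. Hence the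
matrix of `v` is obtained by projecting `M` orthogonally to `I` and `J`, and `v' R v` reduces to
power sums (`exists_optimal_weight`).

**Power.** The limiting power is `χ²(δ_w, 1)((q, ∞))`, as the limit law has no atoms, and it
increases with `δ_w`: a symmetric interval has less normal mass the further the mean is from zero
(`chiSqOne_real_Ioi_mono`).
-/

namespace PanelAR

open scoped NNReal

/-! ### Half-vectorization and the matrix of a linear combination of the moments -/

lemma dup_mulVec {n : ℕ} (v : VechIdx n → ℝ) (ij : Fin n × Fin n) :
    (dup n *ᵥ v) ij = v ⟨(max ij.1 ij.2, min ij.1 ij.2), min_le_max⟩ := by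
  rw [mulVec, dotProduct, Finset.sum_eq_single ⟨(max ij.1 ij.2, min ij.1 ij.2), min_le_max⟩]
  · simp [dup]
  · intro q _ hq
    have : q.1 ≠ (max ij.1 ij.2, min ij.1 ij.2) := fun h => hq (Subtype.ext h)
    simp [dup, this]
  · simp

lemma dup_mulVec_vech {n : ℕ} {A : Matrix (Fin n) (Fin n) ℝ} (hA : A.IsSymm) :
    dup n *ᵥ vech A = fun ij => A ij.1 ij.2 := by
  ext ⟨i, j⟩
  rw [dup_mulVec]
  rcases le_total i j with h | h
  · simpa [vech, h] using hA.apply i j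
  · simp [vech, h]

lemma dup_injective (n : ℕ) : Function.Injective (dup n).mulVec := by
  intro v v' h
  ext ⟨⟨i, j⟩, hq⟩
  have := congrFun h (i, j)
  simp only [dup_mulVec] at this
  simpa [max_eq_left (show j ≤ i from hq), min_eq_right (show j ≤ i from hq)] using this

lemma isUnit_gram_dup (n : ℕ) : IsUnit ((dup n)ᵀ * dup n) := by
  have := Matrix.PosDef.conjTranspose_mul_self (dup n) (dup_injective n)
  rw [conjTranspose_eq_transpose_of_trivial] at this
  exact this.isUnit

lemma dupPinv_mul_dup (n : ℕ) : dupPinv n * dup n = 1 := by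
  rw [dupPinv, Matrix.mul_assoc]
  exact Matrix.nonsing_inv_mul _ ((Matrix.isUnit_iff_isUnit_det _).1 (isUnit_gram_dup n))

/-- The orthogonal projection `dup n * dupPinv n` onto the vectorized symmetric matrices is a
symmetric matrix. -/
lemma dup_mul_dupPinv_isSymm (n : ℕ) : (dup n * dupPinv n).IsSymm := by
  have h : ((dup n)ᵀ * dup n)ᵀ = (dup n)ᵀ * dup n := by simp
  rw [IsSymm, dupPinv, transpose_mul, transpose_mul, transpose_transpose, transpose_nonsing_inv, h,
    Matrix.mul_assoc]

lemma dupPinv_mulVec {n : ℕ} {A : Matrix (Fin n) (Fin n) ℝ} (hA : A.IsSymm) :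
    dupPinv n *ᵥ (fun ij => A ij.1 ij.2) = vech A := by
  rw [← dup_mulVec_vech hA, mulVec_mulVec, dupPinv_mul_dup, one_mulVec]

/-- The symmetric matrix `W` of the linear functional `A ↦ w' P vech A` on symmetric matrices, so
that `w' P vech A = tr (W A)`. -/
noncomputable def weightMat {n : ℕ} (w : MomIdx n → ℝ) : Matrix (Fin n) (Fin n) ℝ :=
  Matrix.of fun i j => ((dupPinv n)ᵀ *ᵥ ((selP n)ᵀ *ᵥ w)) (i, j)

lemma dupPinv_swap {n : ℕ} (q : VechIdx n) (i j : Fin n) :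
    dupPinv n q (i, j) = dupPinv n q (j, i) := by
  simp only [dupPinv, mul_apply, transpose_apply]
  refine Finset.sum_congr rfl fun q' _ => ?_
  simp [dup, max_comm i j, min_comm i j]

lemma weightMat_isSymm {n : ℕ} (w : MomIdx n → ℝ) : (weightMat w).IsSymm := by
  ext i j
  simp only [weightMat, transpose_apply, of_apply, mulVec, dotProduct]
  exact Finset.sum_congr rfl fun q _ => by rw [dupPinv_swap]

lemma sum_prod_mul_eq_trace {n : ℕ} (A : Matrix (Fin n) (Fin n) ℝ) {B : Matrix (Fin n) (Fin n) ℝ}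
    (hB : B.IsSymm) :
    (fun ij : Fin n × Fin n => A ij.1 ij.2) ⬝ᵥ (fun ij => B ij.1 ij.2) = trace (A * B) := by
  simp only [dotProduct, Fintype.sum_prod_type, trace, diag_apply, mul_apply]
  exact Finset.sum_congr rfl fun i _ => Finset.sum_congr rfl fun j _ => by rw [hB.apply i j]

lemma dotProduct_selP_vech {n : ℕ} (w : MomIdx n → ℝ) {A : Matrix (Fin n) (Fin n) ℝ}
    (hA : A.IsSymm) : w ⬝ᵥ (selP n *ᵥ vech A) = trace (weightMat w * A) := by
  rw [← sum_prod_mul_eq_trace _ hA, ← dupPinv_mulVec hA, dotProduct_mulVec, ← mulVec_transpose,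
    dotProduct_mulVec, ← mulVec_transpose]
  rfl

lemma weightMat_eq_zero {n : ℕ} {w : MomIdx n → ℝ} (h : weightMat w = 0) : w = 0 := by
  have h0 : (dupPinv n)ᵀ *ᵥ ((selP n)ᵀ *ᵥ w) = 0 := by
    ext ⟨i, j⟩
    exact congrFun (congrFun h i) j
  have h1 : (selP n)ᵀ *ᵥ w = 0 := by
    have := congrArg (fun x => (dup n)ᵀ *ᵥ x) h0
    rwa [mulVec_mulVec, ← Matrix.transpose_mul, dupPinv_mul_dup, transpose_one, one_mulVec,
      mulVec_zero] at this
  ext q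
  have h2 := congrFun h1 q.1
  rw [mulVec, dotProduct, Finset.sum_eq_single q] at h2
  · simpa [selP] using h2
  · intro q' _ hq'
    have h3 : q.1 ≠ q'.1 := fun h => hq' (Subtype.ext h.symm)
    have h4 : ¬ (q.1.1.1.val = 1 ∧ q.1.1.2.val = 0) := fun h => q.2 ⟨h.2, h.1.le⟩
    simp [selP, h3, h4]
  · simp

lemma gramG_isSymm (n : ℕ) : (gramG n).IsSymm := by
  simp [IsSymm, gramG, transpose_mul]

lemma dotProduct_momentCov {n : ℕ} (w u : MomIdx n → ℝ) :
    w ⬝ᵥ (momentCov n *ᵥ u) =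
      2 * trace (weightMat w * (gramG n * weightMat u * gramG n)) := by
  have hs : (gramG n * weightMat u * gramG n).IsSymm := by
    simp only [IsSymm, transpose_mul, (gramG_isSymm n).eq, (weightMat_isSymm u).eq,
      Matrix.mul_assoc]
  have h : Matrix.kronecker (gramG n) (gramG n) *ᵥ ((dupPinv n)ᵀ *ᵥ ((selP n)ᵀ *ᵥ u)) =
      fun ij => (gramG n * weightMat u * gramG n) ij.1 ij.2 := by
    ext ⟨i, j⟩
    simp only [mulVec, dotProduct, Fintype.sum_prod_type, mul_apply, Finset.sum_mul]
    rw [Finset.sum_comm]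
    refine Finset.sum_congr rfl fun k _ => Finset.sum_congr rfl fun l _ => ?_
    rw [(gramG_isSymm n).apply j k]
    simp only [kronecker, kroneckerMap_apply, weightMat, of_apply, mulVec, dotProduct]
    ring
  rw [← sum_prod_mul_eq_trace _ hs, ← h]
  simp only [momentCov, smul_mulVec, dotProduct_smul, ← mulVec_mulVec, smul_eq_mul]
  rw [dotProduct_mulVec, ← mulVec_transpose, dotProduct_mulVec, ← mulVec_transpose]
  rfl

/-! ### The band matrix, its inverse, and the constraints on weight matrices -/

/-- The matrix `e₁ e₁'`. -/
noncomputable def firstProj (n : ℕ) : Matrix (Fin n) (Fin n) ℝ :=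
  Matrix.diagonal fun i => if i.val = 0 then 1 else 0

lemma firstProj_isSymm (n : ℕ) : (firstProj n).IsSymm := diagonal_transpose _

lemma quasiDiff_mul_apply {n : ℕ} {m : Type*} (r : ℝ) (A : Matrix (Fin n) m ℝ) (i : Fin n) (j : m) :
    (quasiDiff n r * A) i j =
      A i j - r * (if i.val = 0 then 0 else A ⟨i.val - 1, by omega⟩ j) := by
  have h : ∀ k : Fin n, quasiDiff n r i k * A k j =
      (if i = k then A k j else 0) - (if i.val = k.val + 1 then r * A k j else 0) := by
    intro k
    by_cases h1 : i = k
    · subst h1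
      simp [quasiDiff]
    · by_cases h2 : i.val = k.val + 1 <;> simp [quasiDiff, h1, h2]
  rw [mul_apply, Finset.sum_congr rfl fun k _ => h k, Finset.sum_sub_distrib]
  congr 1
  · simp
  · split_ifs with h0
    · simp [h0]
    · rw [Finset.sum_eq_single (⟨i.val - 1, by omega⟩ : Fin n)]
      · rw [if_pos (by simp only; omega)]
      · intro k _ hk
        rw [if_neg]
        intro h'
        exact hk (Fin.ext (by simp only; omega))
      · simp

lemma quasiDiff_eq (n : ℕ) (r : ℝ) : quasiDiff n r = r • quasiDiff n 1 + (1 - r) • 1 := by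
  ext i j
  by_cases h1 : i = j
  · simp [quasiDiff, h1]
  · by_cases h2 : i.val = j.val + 1 <;> simp [quasiDiff, h1, h2]

lemma gramG_apply (n : ℕ) (i j : Fin n) : gramG n i j =
    if i = j then (if i.val = 0 then 1 else 2)
    else if i.val = j.val + 1 ∨ j.val = i.val + 1 then -1 else 0 := by
  rw [gramG, quasiDiff_mul_apply]
  simp only [transpose_apply, quasiDiff, of_apply, Fin.ext_iff]
  split_ifs <;> first | omega | norm_num

lemma quasiDiff_add_transpose (n : ℕ) :
    quasiDiff n 1 + (quasiDiff n 1)ᵀ = gramG n + firstProj n := by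
  ext i j
  simp only [Matrix.add_apply, gramG_apply, transpose_apply, quasiDiff, of_apply, firstProj,
    diagonal_apply, Fin.ext_iff]
  split_ifs <;> first | omega | norm_num

/-- The lower triangular matrix of ones, which is the inverse of `D₁`. -/
noncomputable def cumSum (n : ℕ) : Matrix (Fin n) (Fin n) ℝ :=
  Matrix.of fun i j => if j ≤ i then 1 else 0

lemma quasiDiff_mul_cumSum (n : ℕ) : quasiDiff n 1 * cumSum n = 1 := by
  ext i j
  rw [quasiDiff_mul_apply]
  simp only [cumSum, of_apply, one_apply, Fin.ext_iff, Fin.le_def]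
  split_ifs <;> first | omega | norm_num

lemma cumSum_mul_quasiDiff (n : ℕ) : cumSum n * quasiDiff n 1 = 1 :=
  mul_eq_one_comm.1 (quasiDiff_mul_cumSum n)

/-- The matrix with entries `min (i, j)`, the indices starting from zero. -/
noncomputable def minMat (n : ℕ) : Matrix (Fin n) (Fin n) ℝ :=
  Matrix.of fun i j => (min i.val j.val : ℕ)

lemma minMat_isSymm (n : ℕ) : (minMat n).IsSymm := by
  ext i j
  simp [minMat, min_comm]

/-- The matrix of ones. -/
noncomputable def onesMat (n : ℕ) : Matrix (Fin n) (Fin n) ℝ := Matrix.of fun _ _ => 1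

lemma onesMat_isSymm (n : ℕ) : (onesMat n).IsSymm := rfl

lemma quasiDiff_onesMat (n : ℕ) :
    quasiDiff n 1 * onesMat n * (quasiDiff n 1)ᵀ = firstProj n := by
  have h : quasiDiff n 1 * onesMat n = firstProj n * (cumSum n)ᵀ := by
    ext i j
    rw [quasiDiff_mul_apply, firstProj, diagonal_mul]
    simp only [cumSum, onesMat, of_apply, transpose_apply, Fin.le_def]
    split_ifs <;> first | omega | norm_num
  rw [h, Matrix.mul_assoc, ← transpose_mul, quasiDiff_mul_cumSum, transpose_one, Matrix.mul_one]

lemma quasiDiff_minMat (n : ℕ) :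
    quasiDiff n 1 * minMat n * (quasiDiff n 1)ᵀ = 1 - firstProj n := by
  have h : quasiDiff n 1 * minMat n = (1 - firstProj n) * (cumSum n)ᵀ := by
    ext i j
    rw [quasiDiff_mul_apply, firstProj, Matrix.sub_mul, Matrix.one_mul, Matrix.sub_apply,
      diagonal_mul]
    simp only [cumSum, minMat, of_apply, transpose_apply, Fin.le_def]
    by_cases h0 : i.val = 0
    · simp [h0]
    · by_cases h1 : i.val ≤ j.val
      · rw [if_neg h0, if_pos h1, if_neg h0, min_eq_left h1, min_eq_left (by omega)]
        rw [Nat.cast_sub (by omega)]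
        simp
      · rw [if_neg h0, if_neg h1, if_neg h0, min_eq_right (by omega), min_eq_right (by omega)]
        simp
  rw [h, Matrix.mul_assoc, ← transpose_mul, quasiDiff_mul_cumSum, transpose_one, Matrix.mul_one]

/-- The position `(1, 1)` of a half-vectorization, in numbering from 1. -/
abbrev idxOneOne {n : ℕ} (hn : 2 ≤ n) : VechIdx n := ⟨(⟨0, by omega⟩, ⟨0, by omega⟩), le_rfl⟩

/-- The position `(2, 1)` of a half-vectorization, in numbering from 1. -/
abbrev idxTwoOne {n : ℕ} (hn : 2 ≤ n) : VechIdx n :=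
  ⟨(⟨1, by omega⟩, ⟨0, by omega⟩), by simp [Fin.le_def]⟩

lemma sum_vechIdx {n : ℕ} (hn : 2 ≤ n) (f : VechIdx n → ℝ) :
    ∑ v, f v = f (idxOneOne hn) + f (idxTwoOne hn) + ∑ q : MomIdx n, f q.1 := by
  rw [← Fintype.sum_subtype_add_sum_subtype
    (fun q : VechIdx n => q.1.2.val = 0 ∧ q.1.1.val ≤ 1) f]
  congr 1
  rw [← Finset.sum_subtype {idxOneOne hn, idxTwoOne hn}, Finset.sum_pair]
  · simp
  · rintro ⟨⟨i, j⟩, h⟩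
    simp only [Finset.mem_insert, Finset.mem_singleton, Subtype.mk.injEq, Prod.mk.injEq,
      Fin.ext_iff]
    omega

lemma selP_mulVec {n : ℕ} (hn : 2 ≤ n) (x : VechIdx n → ℝ) (q : MomIdx n) :
    (selP n *ᵥ x) q = x q.1 + gramG n q.1.1.1 q.1.1.2 * x (idxTwoOne hn) := by
  have hq1 : q.1 ≠ idxOneOne hn := fun h => q.2 (by simp [h])
  have hq2 : q.1 ≠ idxTwoOne hn := fun h => q.2 (by simp [h])
  rw [mulVec, dotProduct, sum_vechIdx hn, Finset.sum_eq_single q]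
  · simp [selP, vech, hq1.symm, hq2.symm]
    ring
  · intro q' _ hq'
    have h3 : q'.1 ≠ q.1 := fun h => hq' (Subtype.ext h)
    have h4 : ¬ (q'.1.1.1.val = 1 ∧ q'.1.1.2.val = 0) := fun h => q'.2 ⟨h.2, h.1.le⟩
    simp [selP, h3, h4]
  · simp

lemma selP_vech_gramG {n : ℕ} (hn : 2 ≤ n) : selP n *ᵥ vech (gramG n) = 0 := by
  ext q
  rw [selP_mulVec hn]
  simp [vech, gramG_apply]

lemma vech_firstProj {n : ℕ} (hn : 2 ≤ n) (v : VechIdx n) :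
    vech (firstProj n) v = if v = idxOneOne hn then 1 else 0 := by
  obtain ⟨⟨i, j⟩, h⟩ := v
  simp only [vech, firstProj, diagonal_apply, Subtype.mk.injEq, Prod.mk.injEq, Fin.ext_iff]
  split_ifs <;> first | omega | rfl

lemma selP_vech_firstProj {n : ℕ} (hn : 2 ≤ n) : selP n *ᵥ vech (firstProj n) = 0 := by
  ext q
  have hq1 : q.1 ≠ idxOneOne hn := fun h => q.2 (by simp [h])
  rw [selP_mulVec hn, vech_firstProj hn, vech_firstProj hn]
  simp [hq1]

lemma trace_weightMat_gramG {n : ℕ} (hn : 2 ≤ n) (w : MomIdx n → ℝ) :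
    trace (weightMat w * gramG n) = 0 := by
  rw [← dotProduct_selP_vech _ (gramG_isSymm n), selP_vech_gramG hn, dotProduct_zero]

lemma trace_weightMat_firstProj {n : ℕ} (hn : 2 ≤ n) (w : MomIdx n → ℝ) :
    trace (weightMat w * firstProj n) = 0 := by
  rw [← dotProduct_selP_vech _ (firstProj_isSymm n), selP_vech_firstProj hn, dotProduct_zero]

/-- The two linear constraints satisfied by every `weightMat w` characterize these matrices among
the symmetric ones. -/
lemma exists_weightMat_eq {n : ℕ} (hn : 2 ≤ n) {W : Matrix (Fin n) (Fin n) ℝ} (hW : W.IsSymm)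
    (hG : trace (W * gramG n) = 0) (hE : trace (W * firstProj n) = 0) :
    ∃ u : MomIdx n → ℝ, weightMat u = W := by
  set z : VechIdx n → ℝ := (dup n)ᵀ *ᵥ (fun ij => W ij.1 ij.2) with hz
  have hzA : ∀ A : Matrix (Fin n) (Fin n) ℝ, A.IsSymm → ∑ v, z v * vech A v = trace (W * A) := by
    intro A hA
    rw [← sum_prod_mul_eq_trace W hA, ← dup_mulVec_vech hA, dotProduct_mulVec, ← mulVec_transpose]
    rfl
  have h11 : z (idxOneOne hn) = 0 := by
    have := hzA _ (firstProj_isSymm n)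
    simpa [vech_firstProj hn, hE] using this
  have h21 : z (idxTwoOne hn) = ∑ q : MomIdx n, z q.1 * gramG n q.1.1.1 q.1.1.2 := by
    have := hzA _ (gramG_isSymm n)
    rw [hG, sum_vechIdx hn, h11] at this
    simp only [vech] at this
    have h' : gramG n (idxTwoOne hn).1.1 (idxTwoOne hn).1.2 = -1 := by simp [gramG_apply]
    rw [h'] at this
    linarith
  have hP : (selP n)ᵀ *ᵥ (fun q : MomIdx n => z q.1) = z := by
    ext v
    by_cases hv : v.1.2.val = 0 ∧ v.1.1.val ≤ 1
    · have hvq : ∀ q : MomIdx n, v ≠ q.1 := fun q h => q.2 (h ▸ hv)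
      by_cases h1 : v.1.1.val = 1
      · have hv1 : v = idxTwoOne hn := by
          obtain ⟨⟨i, j⟩, h⟩ := v
          simp only [Subtype.mk.injEq, Prod.mk.injEq, Fin.ext_iff]
          exact ⟨h1, hv.1⟩
        rw [hv1, h21, mulVec, dotProduct]
        refine Finset.sum_congr rfl fun q _ => ?_
        have := hvq q
        rw [hv1] at this
        simp [selP, this, vech, mul_comm]
      · have hv1 : v = idxOneOne hn := by
          obtain ⟨⟨i, j⟩, h⟩ := v
          simp only [Subtype.mk.injEq, Prod.mk.injEq, Fin.ext_iff]
          simp only at hv h1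
          omega
        rw [hv1, h11, mulVec, dotProduct]
        refine Finset.sum_eq_zero fun q _ => ?_
        have := hvq q
        rw [hv1] at this
        simp [selP, this]
    · rw [mulVec, dotProduct, Finset.sum_eq_single (⟨v, hv⟩ : MomIdx n)]
      · simp [selP]
      · intro q _ hq
        have h3 : v ≠ q.1 := fun h => hq (Subtype.ext h.symm)
        have h4 : ¬ (v.1.1.val = 1 ∧ v.1.2.val = 0) := fun h => hv ⟨h.2, h.1.le⟩
        simp [selP, h3, h4]
      · simp
  refine ⟨fun q => z q.1, ?_⟩
  have : (dupPinv n)ᵀ *ᵥ z = fun ij => W ij.1 ij.2 := by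
    rw [hz, mulVec_mulVec, ← transpose_mul, (dup_mul_dupPinv_isSymm n).eq, ← mulVec_mulVec,
      dupPinv_mulVec hW, dup_mulVec_vech hW]
  ext i j
  rw [weightMat, of_apply, hP, this]

/-! ### The asymptotic variance, the drift, and the optimal combination -/

/-- The form `R` as a squared Frobenius norm, which is also the variance of the quadratic form with
matrix `D' W D` in independent standard normal variables. -/
lemma momentCov_form_eq {n : ℕ} (w : MomIdx n → ℝ) :
    w ⬝ᵥ (momentCov n *ᵥ w) =
      2 * trace (((quasiDiff n 1)ᵀ * weightMat w * quasiDiff n 1) *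
        ((quasiDiff n 1)ᵀ * weightMat w * quasiDiff n 1)) := by
  rw [dotProduct_momentCov, gramG, ← Matrix.mul_assoc, ← Matrix.mul_assoc, ← Matrix.mul_assoc,
    ← Matrix.mul_assoc, Matrix.trace_mul_comm]
  simp only [Matrix.mul_assoc]

lemma trace_mul_self_pos {n : ℕ} {B : Matrix (Fin n) (Fin n) ℝ} (hB : B.IsSymm) (h : B ≠ 0) :
    0 < trace (B * B) := by
  have h1 : trace (B * B) = ∑ i, ∑ j, B i j ^ 2 := by
    simp only [trace, diag_apply, mul_apply]
    exact Finset.sum_congr rfl fun i _ => Finset.sum_congr rfl fun j _ => by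
      rw [hB.apply i j, sq]
  rw [h1]
  by_contra! h2
  have h3 : ∑ i, ∑ j, B i j ^ 2 = 0 := le_antisymm h2 (by positivity)
  apply h
  ext i j
  rw [Finset.sum_eq_zero_iff_of_nonneg (fun i _ => by positivity)] at h3
  have h4 := h3 i (Finset.mem_univ i)
  rw [Finset.sum_eq_zero_iff_of_nonneg (fun i _ => by positivity)] at h4
  simpa using h4 j (Finset.mem_univ j)

lemma momentCov_form_pos {n : ℕ} {w : MomIdx n → ℝ} (hw : w ≠ 0) :
    0 < w ⬝ᵥ (momentCov n *ᵥ w) := by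
  rw [momentCov_form_eq]
  refine mul_pos two_pos (trace_mul_self_pos ?_ fun h => hw (weightMat_eq_zero ?_))
  · simp only [IsSymm, transpose_mul, transpose_transpose, (weightMat_isSymm w).eq,
      Matrix.mul_assoc]
  · have h1 : (cumSum n)ᵀ * (quasiDiff n 1)ᵀ = 1 := by
      rw [← transpose_mul, quasiDiff_mul_cumSum, transpose_one]
    calc weightMat w = ((cumSum n)ᵀ * (quasiDiff n 1)ᵀ) * weightMat w *
          (quasiDiff n 1 * cumSum n) := by
            rw [h1, quasiDiff_mul_cumSum, Matrix.one_mul, Matrix.mul_one]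
      _ = (cumSum n)ᵀ * ((quasiDiff n 1)ᵀ * weightMat w * quasiDiff n 1) * cumSum n := by
            simp only [Matrix.mul_assoc]
      _ = 0 := by rw [h]; simp

lemma momentCov_comm {n : ℕ} (w u : MomIdx n → ℝ) :
    w ⬝ᵥ (momentCov n *ᵥ u) = u ⬝ᵥ (momentCov n *ᵥ w) := by
  rw [dotProduct_momentCov, dotProduct_momentCov, Matrix.trace_mul_comm, Matrix.mul_assoc,
    Matrix.mul_assoc, Matrix.trace_mul_comm]
  simp only [Matrix.mul_assoc]

lemma momentCov_isSymm (n : ℕ) : (momentCov n).IsSymm := by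
  ext i j
  have := momentCov_comm (Pi.single j 1 : MomIdx n → ℝ) (Pi.single i 1)
  simpa using this

lemma dotProduct_drift {n : ℕ} (hn : 2 ≤ n) (e : ℝ) (w : MomIdx n → ℝ) :
    w ⬝ᵥ drift n e = e ^ 2 * trace (weightMat w) := by
  have h : (Matrix.diagonal fun i : Fin n => if i.val = 0 then 1 else e ^ 2) =
      e ^ 2 • (1 : Matrix (Fin n) (Fin n) ℝ) + (1 - e ^ 2) • firstProj n := by
    ext i j
    simp only [diagonal_apply, Matrix.add_apply, Matrix.smul_apply, firstProj, one_apply,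
      smul_eq_mul]
    split_ifs <;> ring
  rw [drift, dotProduct_selP_vech _ (diagonal_transpose _), h, Matrix.mul_add, trace_add,
    Matrix.mul_smul, Matrix.mul_smul, trace_smul, trace_smul, trace_weightMat_firstProj hn]
  simp

/-- Adding the last row and column to a sum over `min (i, j)`. -/
lemma sum_min_succ (n : ℕ) (f : ℕ → ℝ) :
    ∑ i ∈ Finset.range (n + 1), ∑ j ∈ Finset.range (n + 1), f (min i j) =
      (∑ i ∈ Finset.range n, ∑ j ∈ Finset.range n, f (min i j)) +
        2 * (∑ i ∈ Finset.range n, f i) + f n := by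
  simp only [Finset.sum_range_succ, Finset.sum_add_distrib, min_self]
  have h1 : ∑ i ∈ Finset.range n, f (min i n) = ∑ i ∈ Finset.range n, f i :=
    Finset.sum_congr rfl fun i hi => by rw [min_eq_left (Finset.mem_range.1 hi).le]
  have h2 : ∑ i ∈ Finset.range n, f (min n i) = ∑ i ∈ Finset.range n, f i :=
    Finset.sum_congr rfl fun i hi => by rw [min_eq_right (Finset.mem_range.1 hi).le]
  rw [h1, h2]
  ring

lemma sum_range_cast (n : ℕ) : ∑ i ∈ Finset.range n, (i : ℝ) = n * (n - 1) / 2 := by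
  induction n with
  | zero => simp
  | succ n ih => rw [Finset.sum_range_succ, ih]; push_cast; ring

lemma sum_range_cast_sq (n : ℕ) :
    ∑ i ∈ Finset.range n, (i : ℝ) ^ 2 = n * (n - 1) * (2 * n - 1) / 6 := by
  induction n with
  | zero => simp
  | succ n ih => rw [Finset.sum_range_succ, ih]; push_cast; ring

lemma sum_min (n : ℕ) : ∑ i ∈ Finset.range n, ∑ j ∈ Finset.range n, ((min i j : ℕ) : ℝ) =
    n * (n - 1) * (2 * n - 1) / 6 := by
  induction n with
  | zero => simp
  | succ n ih =>
    rw [sum_min_succ n (fun k => (k : ℝ)), ih, sum_range_cast]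
    push_cast; ring

lemma sum_min_sq (n : ℕ) :
    ∑ i ∈ Finset.range n, ∑ j ∈ Finset.range n, ((min i j : ℕ) : ℝ) ^ 2 =
      n * (n - 1) * (n ^ 2 - n + 1) / 6 := by
  induction n with
  | zero => simp
  | succ n ih =>
    rw [sum_min_succ n (fun k => (k : ℝ) ^ 2), ih, sum_range_cast_sq]
    push_cast; ring

lemma trace_mul_eq_sum_range {n : ℕ} {A B : Matrix (Fin n) (Fin n) ℝ} (f : ℕ → ℕ → ℝ)
    (h : ∀ i j, A i j * B j i = f i j) :
    trace (A * B) = ∑ i ∈ Finset.range n, ∑ j ∈ Finset.range n, f i j := by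
  simp only [trace, diag_apply, mul_apply, h]
  rw [← Fin.sum_univ_eq_sum_range (fun i => ∑ j ∈ Finset.range n, f i j)]
  exact Finset.sum_congr rfl fun i _ => Fin.sum_univ_eq_sum_range (fun j => f i j) n

lemma trace_minMat (n : ℕ) : trace (minMat n) = n * (n - 1) / 2 := by
  rw [← sum_range_cast, ← Fin.sum_univ_eq_sum_range (fun i => (i : ℝ))]
  simp [trace, minMat]

lemma trace_minMat_mul_onesMat (n : ℕ) :
    trace (minMat n * onesMat n) = n * (n - 1) * (2 * n - 1) / 6 := by
  rw [trace_mul_eq_sum_range (fun i j => ((min i j : ℕ) : ℝ)), sum_min]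
  simp [minMat, onesMat]

lemma trace_minMat_mul_minMat (n : ℕ) :
    trace (minMat n * minMat n) = n * (n - 1) * (n ^ 2 - n + 1) / 6 := by
  rw [trace_mul_eq_sum_range (fun i j => ((min i j : ℕ) : ℝ) ^ 2), sum_min_sq]
  intro i j
  simp [minMat, sq, min_comm]

lemma trace_onesMat (n : ℕ) : trace (onesMat n) = n := by simp [trace, onesMat]

lemma trace_onesMat_mul_onesMat (n : ℕ) : trace (onesMat n * onesMat n) = (n : ℝ) ^ 2 := by
  rw [trace_mul_eq_sum_range (fun _ _ => 1)]
  · simp [sq]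
  · simp [onesMat]

/-- The solution `u` of `momentCov n *ᵥ u = c₁` for `e = 1`. It comes from projecting `minMat n`
orthogonally to the identity and `onesMat n`: these are the images, under the congruence by
`cumSum n`, of the matrices `G` and `e₁ e₁'` that every weight matrix annihilates. -/
lemma exists_optimal_weight {n : ℕ} (hn : 2 ≤ n) : ∃ u : MomIdx n → ℝ,
    (∀ w : MomIdx n → ℝ, w ⬝ᵥ (momentCov n *ᵥ u) = trace (weightMat w)) ∧
    trace (weightMat u) = (2 * (n : ℝ) - 1) * (n + 1) * n * (n - 1) / 72 := by
  set D := quasiDiff n 1 with hD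
  set U := cumSum n with hU
  have hDU : D * U = 1 := quasiDiff_mul_cumSum n
  have hUD : U * D = 1 := cumSum_mul_quasiDiff n
  have hDU' : Uᵀ * Dᵀ = 1 := by rw [← transpose_mul, hDU, transpose_one]
  have hUD' : Dᵀ * Uᵀ = 1 := by rw [← transpose_mul, hUD, transpose_one]
  -- `α` and `β` solve `tr V = 0` and `tr (V J) = 0` for `V = minMat n - α I - β J`,
  -- where `J = onesMat n`.
  set α : ℝ := ((n : ℝ) + 1) / 6 with hα
  set β : ℝ := ((n : ℝ) - 2) / 3 with hβ
  set V : Matrix (Fin n) (Fin n) ℝ := minMat n - α • 1 - β • onesMat n with hV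
  have hVs : V.IsSymm := by
    rw [IsSymm, hV, transpose_sub, transpose_sub, transpose_smul, transpose_smul, transpose_one,
      (minMat_isSymm n).eq, (onesMat_isSymm n).eq]
  have hV1 : trace V = 0 := by
    rw [hV, trace_sub, trace_sub, trace_smul, trace_smul, trace_minMat, trace_one, trace_onesMat,
      Fintype.card_fin, smul_eq_mul, smul_eq_mul, hα, hβ]
    ring
  have hVJ : trace (V * onesMat n) = 0 := by
    rw [hV, Matrix.sub_mul, Matrix.sub_mul, trace_sub, trace_sub, Matrix.smul_mul, Matrix.smul_mul,
      trace_smul, trace_smul, Matrix.one_mul, trace_minMat_mul_onesMat, trace_onesMat,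
      trace_onesMat_mul_onesMat, smul_eq_mul, smul_eq_mul, hα, hβ]
    ring
  have hVM : trace (V * minMat n) = 2 * ((2 * (n : ℝ) - 1) * (n + 1) * n * (n - 1) / 72) := by
    rw [hV, Matrix.sub_mul, Matrix.sub_mul, trace_sub, trace_sub, Matrix.smul_mul, Matrix.smul_mul,
      trace_smul, trace_smul, Matrix.one_mul, trace_minMat, trace_mul_comm (onesMat n),
      trace_minMat_mul_onesMat, trace_minMat_mul_minMat, smul_eq_mul, smul_eq_mul, hα, hβ]
    ring
  -- Congruence by `U` turns `D A D'` into `A` under the trace pairing.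
  have hpair : ∀ A B : Matrix (Fin n) (Fin n) ℝ, D * A * Dᵀ = B →
      trace (((1 / 2 : ℝ) • (Uᵀ * V * U)) * B) = 1 / 2 * trace (V * A) := by
    intro A B hAB
    rw [← hAB, Matrix.smul_mul, trace_smul, smul_eq_mul]
    congr 1
    calc trace (Uᵀ * V * U * (D * A * Dᵀ)) = trace (Uᵀ * (V * ((U * D) * (A * Dᵀ)))) := by
          simp only [Matrix.mul_assoc]
      _ = trace (V * A * (Dᵀ * Uᵀ)) := by
          rw [hUD, Matrix.one_mul, trace_mul_comm]; simp only [Matrix.mul_assoc]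
      _ = trace (V * A) := by rw [hUD', Matrix.mul_one]
  obtain ⟨u, hu⟩ := exists_weightMat_eq hn (W := (1 / 2 : ℝ) • (Uᵀ * V * U))
    (by simp only [IsSymm, transpose_smul, transpose_mul, transpose_transpose, hVs.eq,
      Matrix.mul_assoc])
    (by rw [hpair 1 (gramG n) (by rw [Matrix.mul_one, gramG]), Matrix.mul_one, hV1, mul_zero])
    (by rw [hpair _ _ (quasiDiff_onesMat n), hVJ, mul_zero])
  refine ⟨u, fun w => ?_, ?_⟩
  · have hG : gramG n * weightMat u * gramG n = (1 / 2 : ℝ) • (D * V * Dᵀ) := by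
      rw [hu, gramG, ← hD, Matrix.mul_smul, Matrix.smul_mul]
      congr 1
      calc D * Dᵀ * (Uᵀ * V * U) * (D * Dᵀ) = D * (Dᵀ * Uᵀ) * V * (U * D) * Dᵀ := by
            simp only [Matrix.mul_assoc]
        _ = D * V * Dᵀ := by rw [hUD', hUD, Matrix.mul_one, Matrix.mul_one]
    have hDV : D * V * Dᵀ = 1 - firstProj n - α • gramG n - β • firstProj n := by
      rw [hV, Matrix.mul_sub, Matrix.mul_sub, Matrix.sub_mul, Matrix.sub_mul, quasiDiff_minMat,
        Matrix.mul_smul, Matrix.mul_smul, Matrix.smul_mul, Matrix.smul_mul, quasiDiff_onesMat,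
        Matrix.mul_one, gramG]
    rw [dotProduct_momentCov, hG, hDV, Matrix.mul_smul, trace_smul, Matrix.mul_sub, Matrix.mul_sub,
      Matrix.mul_sub, trace_sub, trace_sub, trace_sub, Matrix.mul_smul, Matrix.mul_smul, trace_smul,
      trace_smul, trace_weightMat_gramG hn, trace_weightMat_firstProj hn, Matrix.mul_one]
    simp
  · have h1 := hpair _ _ (quasiDiff_minMat n)
    rw [← hu, Matrix.mul_sub, trace_sub, trace_weightMat_firstProj hn, Matrix.mul_one, hVM] at h1
    linarith

/-! ### Maximizing the noncentrality: Rayleigh quotients of rank one -/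

section RayleighQuotient

variable {ι : Type*} [Fintype ι] {R : Matrix ι ι ℝ} {v : ι → ℝ}

/-- The Cauchy-Schwarz gap for the form `R`, as the value of the form at a vector. -/
lemma form_smul_sub_smul (hR : R.IsSymm) (w : ι → ℝ) (s b : ℝ) (hs : s = w ⬝ᵥ (R *ᵥ w))
    (hb : b = w ⬝ᵥ (R *ᵥ v)) :
    (s • v - b • w) ⬝ᵥ (R *ᵥ (s • v - b • w)) = s * (s * (v ⬝ᵥ (R *ᵥ v)) - b ^ 2) := by
  have h : v ⬝ᵥ (R *ᵥ w) = b := by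
    rw [hb, dotProduct_mulVec, ← mulVec_transpose, hR.eq, dotProduct_comm]
  simp only [mulVec_sub, mulVec_smul, dotProduct_sub, sub_dotProduct, smul_dotProduct,
    dotProduct_smul, smul_eq_mul, h, ← hs, ← hb]
  ring

/-- The Cauchy-Schwarz inequality for a positive definite form. -/
lemma sq_dotProduct_le (hR : R.IsSymm) (hpos : ∀ w, w ≠ 0 → 0 < w ⬝ᵥ (R *ᵥ w)) (w : ι → ℝ) :
    (w ⬝ᵥ (R *ᵥ v)) ^ 2 ≤ (v ⬝ᵥ (R *ᵥ v)) * (w ⬝ᵥ (R *ᵥ w)) := by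
  by_cases hw : w = 0
  · simp [hw]
  have h0 : ∀ x, 0 ≤ x ⬝ᵥ (R *ᵥ x) := fun x => by
    by_cases hx : x = 0
    · simp [hx]
    · exact (hpos x hx).le
  have h1 := h0 ((w ⬝ᵥ (R *ᵥ w)) • v - (w ⬝ᵥ (R *ᵥ v)) • w)
  rw [form_smul_sub_smul hR w _ _ rfl rfl] at h1
  have := nonneg_of_mul_nonneg_right h1 (hpos w hw)
  linarith

/-- The equality case of the Cauchy-Schwarz inequality, written as an eigenvector equation for the
pencil of `c c'` and `R`, where `c = R v`. -/
lemma rayleigh_eq_iff (hR : R.IsSymm) (hpos : ∀ w, w ≠ 0 → 0 < w ⬝ᵥ (R *ᵥ w)) {w : ι → ℝ}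
    (hw : w ≠ 0) :
    (w ⬝ᵥ (R *ᵥ v)) ^ 2 / (w ⬝ᵥ (R *ᵥ w)) = v ⬝ᵥ (R *ᵥ v) ↔
      Matrix.vecMulVec (R *ᵥ v) (R *ᵥ v) *ᵥ w = (v ⬝ᵥ (R *ᵥ v)) • (R *ᵥ w) := by
  have hs := hpos w hw
  have hvec : Matrix.vecMulVec (R *ᵥ v) (R *ᵥ v) *ᵥ w = (w ⬝ᵥ (R *ᵥ v)) • (R *ᵥ v) := by
    rw [vecMulVec_mulVec, dotProduct_comm]
    ext i
    simp [mul_comm]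
  rw [hvec, div_eq_iff hs.ne']
  constructor
  · intro h
    have h1 := form_smul_sub_smul (v := v) hR w _ _ rfl rfl
    rw [h, mul_comm (w ⬝ᵥ (R *ᵥ w)) (v ⬝ᵥ (R *ᵥ v)), sub_self, mul_zero] at h1
    have h2 : (w ⬝ᵥ (R *ᵥ w)) • v - (w ⬝ᵥ (R *ᵥ v)) • w = 0 := by
      by_contra h3
      exact (hpos _ h3).ne' h1
    have h3 := congrArg (fun x => R *ᵥ x) (sub_eq_zero.1 h2)
    simp only [mulVec_smul] at h3
    refine smul_right_injective _ hs.ne' ?_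
    simp only
    rw [smul_comm, h3, smul_smul, smul_smul, ← sq, h, mul_comm]
  · intro h
    have h1 := congrArg (fun x => w ⬝ᵥ x) h
    simpa [dotProduct_smul, sq] using h1

/-- For `c = R v`, the pencil `l R - c c'` has the largest root `v' R v` as soon as some nonzero `w`
solves the eigenvector equation for that value. -/
lemma isGreatest_generalized_eigenvalue [DecidableEq ι] (hR : R.IsSymm)
    (hpos : ∀ w, w ≠ 0 → 0 < w ⬝ᵥ (R *ᵥ w)) {w : ι → ℝ} (hw : w ≠ 0)
    (h : Matrix.vecMulVec (R *ᵥ v) (R *ᵥ v) *ᵥ w = (v ⬝ᵥ (R *ᵥ v)) • (R *ᵥ w)) :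
    IsGreatest {l : ℝ | (l • R - Matrix.vecMulVec (R *ᵥ v) (R *ᵥ v)).det = 0}
      (v ⬝ᵥ (R *ᵥ v)) := by
  refine ⟨exists_mulVec_eq_zero_iff.1 ⟨w, hw, by rw [sub_mulVec, smul_mulVec, h, sub_self]⟩, ?_⟩
  intro l hl
  obtain ⟨x, hx, hx0⟩ := exists_mulVec_eq_zero_iff.2 hl
  have h1 := congrArg (fun y => x ⬝ᵥ y) hx0
  have hvec : x ⬝ᵥ (Matrix.vecMulVec (R *ᵥ v) (R *ᵥ v) *ᵥ x) = (x ⬝ᵥ (R *ᵥ v)) ^ 2 := by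
    rw [vecMulVec_mulVec, dotProduct_comm (R *ᵥ v) x, sq]
    simp
  simp only [sub_mulVec, smul_mulVec, dotProduct_sub, dotProduct_smul, hvec, smul_eq_mul,
    dotProduct_zero] at h1
  have h2 := sq_dotProduct_le (v := v) hR hpos x
  have h3 := hpos x hx
  exact le_of_mul_le_mul_right (by linarith) h3

end RayleighQuotient

/-- The maximal noncentrality parameter, in terms of the number `n = T - 1` of differences. -/
lemma exists_drift_eq {n : ℕ} (hn : 2 ≤ n) (e : ℝ) : ∃ u : MomIdx n → ℝ, u ≠ 0 ∧
    drift n e = momentCov n *ᵥ (e ^ 2 • u) ∧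
    (e ^ 2 • u) ⬝ᵥ (momentCov n *ᵥ (e ^ 2 • u)) =
      e ^ 4 * ((2 * (n : ℝ) - 1) * (n + 1) * n * (n - 1) / 72) ∧
    Matrix.vecMulVec (drift n e) (drift n e) *ᵥ u =
      (e ^ 4 * ((2 * (n : ℝ) - 1) * (n + 1) * n * (n - 1) / 72)) • (momentCov n *ᵥ u) := by
  obtain ⟨u, hu, hu2⟩ := exists_optimal_weight hn
  have hc : drift n e = e ^ 2 • (momentCov n *ᵥ u) := by
    ext i
    have h := dotProduct_drift hn e (Pi.single i 1)
    rw [← hu, ← smul_eq_mul, ← dotProduct_smul] at h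
    simpa using h
  refine ⟨u, ?_, ?_, ?_, ?_⟩
  · rintro rfl
    have hn' : (2 : ℝ) ≤ n := by exact_mod_cast hn
    have h1 : (0 : ℝ) < (2 * (n : ℝ) - 1) * (n + 1) * n * (n - 1) / 72 := by
      have : (0 : ℝ) < 2 * n - 1 := by linarith
      have : (0 : ℝ) < n - 1 := by linarith
      positivity
    rw [← hu2, ← hu] at h1
    simp at h1
  · rw [hc, mulVec_smul]
  · rw [mulVec_smul, smul_dotProduct, dotProduct_smul, hu, hu2, smul_eq_mul, smul_eq_mul]
    ring
  · rw [hc, vecMulVec_mulVec, smul_dotProduct, dotProduct_comm, hu, hu2]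
    ext i
    simp
    ring

lemma noncentrality_eq {n : ℕ} (e : ℝ) (w : MomIdx n → ℝ) :
    noncentrality n e w = (w ⬝ᵥ drift n e) ^ 2 / (w ⬝ᵥ (momentCov n *ᵥ w)) := by
  rw [noncentrality, dotProduct_comm (drift n e) w, sq, div_eq_mul_inv]
  ring

lemma noncentrality_smul {n : ℕ} (e : ℝ) (w : MomIdx n → ℝ) {a : ℝ} (ha : a ≠ 0) :
    noncentrality n e (a • w) = noncentrality n e w := by
  simp only [noncentrality_eq, mulVec_smul, smul_dotProduct, dotProduct_smul, smul_eq_mul]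
  rw [mul_pow, ← mul_assoc, ← sq, mul_div_mul_left _ _ (pow_ne_zero 2 ha)]

/-! ### Moments of quadratic forms in normal variables -/

section GaussianMoments

/-- One step of the differentiation of the Gaussian moment generating function. -/
lemma deriv_mul_exp_sq {v : ℝ} {p p' : ℝ → ℝ} (hp : ∀ t, HasDerivAt p (p' t) t) :
    deriv (fun t => p t * Real.exp (v * t ^ 2 / 2)) =
      fun t => (p' t + p t * (v * t)) * Real.exp (v * t ^ 2 / 2) := by
  ext t
  have h1 : HasDerivAt (fun t => v * t ^ 2 / 2) (v * t) t := by
    have := (((hasDerivAt_id t).pow 2).const_mul v).div_const 2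
    convert! this using 1
    simp
    ring
  refine ((hp t).mul h1.exp).deriv.trans ?_
  ring

/-- The fourth moment, by differentiating the moment generating function `exp (v t² / 2)`. -/
lemma integral_pow_four_gaussianReal (v : ℝ≥0) :
    ∫ x, x ^ 4 ∂gaussianReal 0 v = 3 * (v : ℝ) ^ 2 := by
  have h := iteratedDeriv_mgf_zero (X := fun x : ℝ => x) (μ := gaussianReal 0 v) (by simp) 4
  have h1 : deriv (fun t : ℝ => 1 * Real.exp (v * t ^ 2 / 2)) =
      fun t => (v * t) * Real.exp (v * t ^ 2 / 2) := by
    rw [deriv_mul_exp_sq (p' := fun _ => 0) fun t => hasDerivAt_const t _]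
    ext t; ring
  have h2 : deriv (fun t : ℝ => (v * t) * Real.exp (v * t ^ 2 / 2)) =
      fun t => (v + v ^ 2 * t ^ 2) * Real.exp (v * t ^ 2 / 2) := by
    rw [deriv_mul_exp_sq (p' := fun _ => (v : ℝ)) fun t => by
      simpa using (hasDerivAt_id t).const_mul (v : ℝ)]
    ext t; ring
  have h3 : deriv (fun t : ℝ => (v + v ^ 2 * t ^ 2) * Real.exp (v * t ^ 2 / 2)) =
      fun t => (3 * v ^ 2 * t + v ^ 3 * t ^ 3) * Real.exp (v * t ^ 2 / 2) := by
    rw [deriv_mul_exp_sq (p' := fun t => (v : ℝ) ^ 2 * (2 * t)) fun t => by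
      simpa using (((hasDerivAt_id t).pow 2).const_mul ((v : ℝ) ^ 2)).const_add (v : ℝ)]
    ext t; ring
  have h4 : deriv (fun t : ℝ => (3 * v ^ 2 * t + v ^ 3 * t ^ 3) * Real.exp (v * t ^ 2 / 2)) =
      fun t => (3 * v ^ 2 + 6 * v ^ 3 * t ^ 2 + v ^ 4 * t ^ 4) * Real.exp (v * t ^ 2 / 2) := by
    rw [deriv_mul_exp_sq (p' := fun t => 3 * (v : ℝ) ^ 2 + (v : ℝ) ^ 3 * (3 * t ^ 2)) fun t => by
      have := ((hasDerivAt_id t).const_mul (3 * (v : ℝ) ^ 2)).add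
        (((hasDerivAt_id t).pow 3).const_mul ((v : ℝ) ^ 3))
      convert! this using 1
      simp]
    ext t; ring
  have h0 : mgf (fun x : ℝ => x) (gaussianReal 0 v) =
      fun t : ℝ => 1 * Real.exp (v * t ^ 2 / 2) := by
    rw [mgf_fun_id_gaussianReal]
    ext t; simp
  rw [h0, iteratedDeriv_succ, iteratedDeriv_succ, iteratedDeriv_succ, iteratedDeriv_one, h1, h2,
    h3, h4] at h
  simpa using h.symm

/-- The law of a vector of `n` independent centered normal variables with variance `v`. -/
noncomputable abbrev gaussVec (n : ℕ) (v : ℝ≥0) : Measure (Fin n → ℝ) :=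
  Measure.pi fun _ => gaussianReal 0 v

variable {n : ℕ} {v : ℝ≥0}

lemma integrable_eval_gaussVec (i : Fin n) : Integrable (fun x => x i) (gaussVec n v) := by
  have := (measurePreserving_eval (fun _ : Fin n => gaussianReal 0 v) i)
  exact this.integrable_comp_of_integrable (g := id)
    ((memLp_id_gaussianReal 1).integrable (by simp))

lemma integral_eval_gaussVec (i : Fin n) : ∫ x, x i ∂gaussVec n v = 0 := by
  have h := (measurePreserving_eval (fun _ : Fin n => gaussianReal 0 v) i).hasLaw.integral_eq
  rw [integral_id_gaussianReal] at h
  exact h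

lemma map_dotProduct_gaussVec (a : Fin n → ℝ) :
    (gaussVec n v).map (fun x => a ⬝ᵥ x) = gaussianReal 0 (v * (a ⬝ᵥ a).toNNReal) := by
  have hG : HasGaussianLaw (fun x : Fin n → ℝ => x) (gaussVec n v) :=
    (iIndepFun_pi (X := fun _ x => x) fun _ => aemeasurable_id).hasGaussianLaw fun i =>
      (measurePreserving_eval (fun _ : Fin n => gaussianReal 0 v) i).hasLaw.hasGaussianLaw
  have hG2 : HasGaussianLaw (fun x : Fin n → ℝ => a ⬝ᵥ x) (gaussVec n v) := by
    convert! hG.map (∑ i, a i • ContinuousLinearMap.proj (R := ℝ) (φ := fun _ : Fin n => ℝ) i)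
      using 1
    ext x
    simp [dotProduct]
  have hmean : ∫ x, a ⬝ᵥ x ∂gaussVec n v = 0 := by
    simp only [dotProduct]
    rw [integral_finsetSum _ fun i _ => (integrable_eval_gaussVec i).const_mul _]
    refine Finset.sum_eq_zero fun i _ => ?_
    rw [integral_const_mul, integral_eval_gaussVec, mul_zero]
  have hvar : Var[fun x => a ⬝ᵥ x; gaussVec n v] = v * (a ⬝ᵥ a) := by
    have h1 : (fun x : Fin n → ℝ => a ⬝ᵥ x) = ∑ i, fun x : Fin n → ℝ => a i * x i := by
      ext x
      simp [dotProduct]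
    rw [h1, variance_sum_pi (X := fun i x => a i * x)]
    · change ∑ i, Var[fun x => a i * id x; gaussianReal 0 v] = _
      simp_rw [variance_const_mul, variance_id_gaussianReal]
      rw [dotProduct, Finset.mul_sum]
      exact Finset.sum_congr rfl fun i _ => by ring
    · exact fun i => (memLp_id_gaussianReal 2).const_mul _
  rw [hG2.map_eq_gaussianReal, hmean, hvar, Real.toNNReal_mul (by positivity)]
  simp

lemma measurable_dotProduct_right (a : Fin n → ℝ) : Measurable fun x : Fin n → ℝ => a ⬝ᵥ x := by
  unfold dotProduct
  fun_prop

lemma integrable_dotProduct_pow_four (a : Fin n → ℝ) :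
    Integrable (fun x => (a ⬝ᵥ x) ^ 4) (gaussVec n v) := by
  have hm : AEMeasurable (fun x : Fin n → ℝ => a ⬝ᵥ x) (gaussVec n v) :=
    (measurable_dotProduct_right a).aemeasurable
  have h : Integrable (fun y : ℝ => y ^ 4) ((gaussVec n v).map fun x => a ⬝ᵥ x) := by
    rw [map_dotProduct_gaussVec]
    have := (memLp_id_gaussianReal (μ := 0) (v := v * (a ⬝ᵥ a).toNNReal) 4).integrable_norm_pow
      (by norm_num)
    refine this.congr (ae_of_all _ fun x => ?_)
    simp only [id, Real.norm_eq_abs]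
    exact (Even.pow_abs (by decide) x)
  exact h.comp_aemeasurable hm

lemma integral_dotProduct_pow_four (a : Fin n → ℝ) :
    ∫ x, (a ⬝ᵥ x) ^ 4 ∂gaussVec n v = 3 * (v : ℝ) ^ 2 * (a ⬝ᵥ a) ^ 2 := by
  have hm : AEMeasurable (fun x : Fin n → ℝ => a ⬝ᵥ x) (gaussVec n v) :=
    (measurable_dotProduct_right a).aemeasurable
  have h := integral_map (f := fun y : ℝ => y ^ 4) hm (by fun_prop)
  rw [map_dotProduct_gaussVec, integral_pow_four_gaussianReal] at h
  rw [← h, NNReal.coe_mul, Real.coe_toNNReal _ (by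
    rw [dotProduct]; exact Finset.sum_nonneg fun i _ => mul_self_nonneg _)]
  ring

lemma integrable_dotProduct_sq (a : Fin n → ℝ) :
    Integrable (fun x => (a ⬝ᵥ x) ^ 2) (gaussVec n v) := by
  have h : Integrable (fun y : ℝ => y ^ 2) ((gaussVec n v).map fun x => a ⬝ᵥ x) := by
    rw [map_dotProduct_gaussVec]
    exact (memLp_id_gaussianReal 2).integrable_sq
  exact h.comp_measurable (measurable_dotProduct_right a)

lemma integral_dotProduct_sq (a : Fin n → ℝ) :
    ∫ x, (a ⬝ᵥ x) ^ 2 ∂gaussVec n v = v * (a ⬝ᵥ a) := by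
  have h := integral_map (μ := gaussVec n v) (f := fun y : ℝ => y ^ 2)
    (measurable_dotProduct_right a).aemeasurable (by fun_prop)
  have h2 := variance_of_integral_eq_zero (μ := gaussianReal 0 (v * (a ⬝ᵥ a).toNNReal))
    (X := fun x => x) (by fun_prop) (by simp)
  rw [map_dotProduct_gaussVec, ← h2, variance_fun_id_gaussianReal] at h
  rw [← h, NNReal.coe_mul, Real.coe_toNNReal _ (by
    rw [dotProduct]; exact Finset.sum_nonneg fun i _ => mul_self_nonneg _)]

/-- Polarization of the product of four linear forms into fourth powers. -/
lemma mul_four_polarization (a b c d : ℝ) : a * b * c * d =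
    (1 / 192) * ((a + b + c + d) ^ 4 - (a + b + c - d) ^ 4 - (a + b - c + d) ^ 4
      + (a + b - c - d) ^ 4 - (a - b + c + d) ^ 4 + (a - b + c - d) ^ 4 + (a - b - c + d) ^ 4
      - (a - b - c - d) ^ 4) := by
  ring

lemma integrable_mul_four (a b c d : Fin n → ℝ) :
    Integrable (fun x => (a ⬝ᵥ x) * (b ⬝ᵥ x) * (c ⬝ᵥ x) * (d ⬝ᵥ x)) (gaussVec n v) := by
  simp only [mul_four_polarization, ← add_dotProduct, ← sub_dotProduct]
  refine Integrable.const_mul ?_ _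
  exact (((((((integrable_dotProduct_pow_four _).sub (integrable_dotProduct_pow_four _)).sub
    (integrable_dotProduct_pow_four _)).add (integrable_dotProduct_pow_four _)).sub
    (integrable_dotProduct_pow_four _)).add (integrable_dotProduct_pow_four _)).add
    (integrable_dotProduct_pow_four _)).sub (integrable_dotProduct_pow_four _)

/-- Isserlis' formula for four linear forms, obtained by polarizing the fourth moment. -/
lemma integral_mul_four (a b c d : Fin n → ℝ) :
    ∫ x, (a ⬝ᵥ x) * (b ⬝ᵥ x) * (c ⬝ᵥ x) * (d ⬝ᵥ x) ∂gaussVec n v =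
      (v : ℝ) ^ 2 * ((a ⬝ᵥ b) * (c ⬝ᵥ d) + (a ⬝ᵥ c) * (b ⬝ᵥ d) + (a ⬝ᵥ d) * (b ⬝ᵥ c)) := by
  have hi := fun a : Fin n → ℝ => integrable_dotProduct_pow_four (v := v) a
  simp only [mul_four_polarization, ← add_dotProduct, ← sub_dotProduct]
  rw [integral_const_mul, integral_sub, integral_add, integral_add, integral_sub, integral_add,
    integral_sub, integral_sub]
  · simp only [integral_dotProduct_pow_four]
    simp only [add_dotProduct, sub_dotProduct, dotProduct_add,
      dotProduct_sub, dotProduct_comm b a, dotProduct_comm c a, dotProduct_comm d a,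
      dotProduct_comm c b, dotProduct_comm d b, dotProduct_comm d c]
    ring
  all_goals
    repeat' first | exact hi _ | apply Integrable.sub | apply Integrable.add

lemma single_dotProduct_single (i j : Fin n) :
    (Pi.single i 1 : Fin n → ℝ) ⬝ᵥ Pi.single j 1 = if i = j then 1 else 0 := by
  simp [Pi.single_apply, eq_comm]

lemma integrable_coord_four (i j k l : Fin n) :
    Integrable (fun x => x i * x j * (x k * x l)) (gaussVec n v) := by
  have := integrable_mul_four (v := v) (Pi.single i 1 : Fin n → ℝ) (Pi.single j 1) (Pi.single k 1)
    (Pi.single l 1)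
  simpa [mul_assoc] using this

lemma integral_coord_four (i j k l : Fin n) :
    ∫ x, x i * x j * (x k * x l) ∂gaussVec n v =
      (v : ℝ) ^ 2 * ((if i = j then 1 else 0) * (if k = l then 1 else 0)
        + (if i = k then 1 else 0) * (if j = l then 1 else 0)
        + (if i = l then 1 else 0) * (if j = k then 1 else 0)) := by
  have := integral_mul_four (v := v) (Pi.single i 1 : Fin n → ℝ) (Pi.single j 1) (Pi.single k 1)
    (Pi.single l 1)
  simp only [single_dotProduct_single] at this
  rw [← this]
  simp [mul_assoc]

lemma memLp_coord_mul (i j : Fin n) : MemLp (fun x => x i * x j) 2 (gaussVec n v) := by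
  rw [memLp_two_iff_integrable_sq (by fun_prop)]
  simpa only [sq] using integrable_coord_four (v := v) i j i j

lemma integral_coord_mul (i j : Fin n) :
    ∫ x, x i * x j ∂gaussVec n v = if i = j then (v : ℝ) else 0 := by
  have hi := fun a : Fin n → ℝ => integrable_dotProduct_sq (v := v) a
  have h : ∀ x : Fin n → ℝ, x i * x j =
      (1 / 4) * (((Pi.single i 1 + Pi.single j 1 : Fin n → ℝ) ⬝ᵥ x) ^ 2
        - ((Pi.single i 1 - Pi.single j 1 : Fin n → ℝ) ⬝ᵥ x) ^ 2) := by
    intro x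
    simp only [add_dotProduct, sub_dotProduct, single_one_dotProduct]
    ring
  simp only [h]
  rw [integral_const_mul, integral_sub (hi _) (hi _), integral_dotProduct_sq,
    integral_dotProduct_sq]
  simp only [add_dotProduct, sub_dotProduct, dotProduct_add, dotProduct_sub,
    single_dotProduct_single, eq_comm (a := j) (b := i)]
  split_ifs <;> ring

/-- The quadratic form of the matrix `B`. -/
def quadForm (B : Matrix (Fin n) (Fin n) ℝ) (x : Fin n → ℝ) : ℝ := x ⬝ᵥ (B *ᵥ x)

lemma quadForm_eq_sum (B : Matrix (Fin n) (Fin n) ℝ) (x : Fin n → ℝ) :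
    quadForm B x = ∑ i, ∑ j, B i j * (x i * x j) := by
  simp only [quadForm, dotProduct, mulVec, Finset.mul_sum]
  exact Finset.sum_congr rfl fun i _ => Finset.sum_congr rfl fun j _ => by ring

lemma measurable_quadForm (B : Matrix (Fin n) (Fin n) ℝ) : Measurable (quadForm B) := by
  have : quadForm B = fun x => ∑ i, ∑ j, B i j * (x i * x j) := funext (quadForm_eq_sum B)
  rw [this]
  fun_prop

lemma memLp_quadForm (B : Matrix (Fin n) (Fin n) ℝ) : MemLp (quadForm B) 2 (gaussVec n v) := by
  have : quadForm B = fun x => ∑ i, ∑ j, B i j * (x i * x j) := funext (quadForm_eq_sum B)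
  rw [this]
  exact memLp_finsetSum _ fun i _ => memLp_finsetSum _ fun j _ =>
    (memLp_coord_mul i j).const_mul _

lemma integral_quadForm (B : Matrix (Fin n) (Fin n) ℝ) :
    ∫ x, quadForm B x ∂gaussVec n v = v * trace B := by
  have hi : ∀ i j, Integrable (fun x : Fin n → ℝ => B i j * (x i * x j)) (gaussVec n v) :=
    fun i j => ((memLp_coord_mul i j).integrable (by norm_num)).const_mul _
  simp only [quadForm_eq_sum]
  rw [integral_finsetSum _ fun i _ => integrable_finsetSum _ fun j _ => hi i j, trace,
    Finset.mul_sum]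
  refine Finset.sum_congr rfl fun i _ => ?_
  rw [integral_finsetSum _ fun j _ => hi i j]
  simp [integral_const_mul, integral_coord_mul, mul_comm]

lemma integral_quadForm_sq {B : Matrix (Fin n) (Fin n) ℝ} (hB : B.IsSymm) :
    ∫ x, quadForm B x ^ 2 ∂gaussVec n v = (v : ℝ) ^ 2 * (trace B ^ 2 + 2 * trace (B * B)) := by
  have hi : ∀ i j k l, Integrable (fun x : Fin n → ℝ =>
      B i j * B k l * (x i * x j * (x k * x l))) (gaussVec n v) :=
    fun i j k l => (integrable_coord_four i j k l).const_mul _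
  have h1 : ∀ x, quadForm B x ^ 2 =
      ∑ i, ∑ j, ∑ k, ∑ l, B i j * B k l * (x i * x j * (x k * x l)) := by
    intro x
    simp only [quadForm_eq_sum, sq, Finset.sum_mul, Finset.mul_sum]
    refine Finset.sum_congr rfl fun i _ => Finset.sum_congr rfl fun j _ =>
      Finset.sum_congr rfl fun k _ => Finset.sum_congr rfl fun l _ => by ring
  have h2 : ∫ x, quadForm B x ^ 2 ∂gaussVec n v = ∑ i, ∑ j, ∑ k, ∑ l, B i j * B k l *
      ∫ x, x i * x j * (x k * x l) ∂gaussVec n v := by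
    simp only [h1]
    rw [integral_finsetSum _ fun i _ => integrable_finsetSum _ fun j _ =>
      integrable_finsetSum _ fun k _ => integrable_finsetSum _ fun l _ => hi i j k l]
    refine Finset.sum_congr rfl fun i _ => ?_
    rw [integral_finsetSum _ fun j _ =>
      integrable_finsetSum _ fun k _ => integrable_finsetSum _ fun l _ => hi i j k l]
    refine Finset.sum_congr rfl fun j _ => ?_
    rw [integral_finsetSum _ fun k _ => integrable_finsetSum _ fun l _ => hi i j k l]
    refine Finset.sum_congr rfl fun k _ => ?_
    rw [integral_finsetSum _ fun l _ => hi i j k l]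
    exact Finset.sum_congr rfl fun l _ => integral_const_mul _ _
  have h3 : trace B ^ 2 = ∑ i, ∑ j, ∑ k, ∑ l, B i j * B k l *
      ((if i = j then 1 else 0) * (if k = l then 1 else 0)) := by
    simp only [sq, trace, Finset.sum_mul, Finset.mul_sum]
    refine Finset.sum_congr rfl fun i _ => ?_
    simp [mul_comm]
  have h4 : trace (B * B) = ∑ i, ∑ j, ∑ k, ∑ l, B i j * B k l *
      ((if i = k then 1 else 0) * (if j = l then 1 else 0)) := by
    simp only [trace, diag_apply, mul_apply]
    refine Finset.sum_congr rfl fun i _ => Finset.sum_congr rfl fun j _ => ?_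
    rw [hB.apply i j]
    simp
  have h5 : trace (B * B) = ∑ i, ∑ j, ∑ k, ∑ l, B i j * B k l *
      ((if i = l then 1 else 0) * (if j = k then 1 else 0)) := by
    simp only [trace, diag_apply, mul_apply]
    refine Finset.sum_congr rfl fun i _ => Finset.sum_congr rfl fun j _ => ?_
    simp
  rw [h2, two_mul]
  nth_rewrite 1 [h4]
  rw [h5, h3]
  simp only [integral_coord_four, Finset.mul_sum, ← Finset.sum_add_distrib]
  refine Finset.sum_congr rfl fun i _ => Finset.sum_congr rfl fun j _ =>
      Finset.sum_congr rfl fun k _ => Finset.sum_congr rfl fun l _ => by ring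

end GaussianMoments

/-! ### Limit theorems for a ratio of sample moments under local alternatives -/

section Convergence

/-- Convergence in distribution only depends on the laws. -/
lemma tendstoInDistribution_congr_law {Ω Ω₁ : ℕ → Type*} {Ω' Ω₁' : Type*}
    [∀ N, MeasurableSpace (Ω N)] [∀ N, MeasurableSpace (Ω₁ N)] [MeasurableSpace Ω']
    [MeasurableSpace Ω₁'] {P : ∀ N, Measure (Ω N)} {P₁ : ∀ N, Measure (Ω₁ N)}
    [∀ N, IsProbabilityMeasure (P N)] [∀ N, IsProbabilityMeasure (P₁ N)]
    {P' : Measure Ω'} {P₁' : Measure Ω₁'} [IsProbabilityMeasure P'] [IsProbabilityMeasure P₁']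
    {X : ∀ N, Ω N → ℝ} {X₁ : ∀ N, Ω₁ N → ℝ} {Z : Ω' → ℝ} {Z₁ : Ω₁' → ℝ}
    (hX : ∀ N, AEMeasurable (X N) (P N)) (hZ : AEMeasurable Z P')
    (hXl : ∀ N, (P N).map (X N) = (P₁ N).map (X₁ N)) (hZl : P'.map Z = P₁'.map Z₁)
    (h : TendstoInDistribution X₁ atTop Z₁ P₁ P₁') : TendstoInDistribution X atTop Z P P' where
  forall_aemeasurable := hX
  aemeasurable_limit := hZ
  tendsto := by
    have := h.tendsto
    simpa only [hXl, hZl] using this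

lemma map_gaussianReal_sq_eq_chiSqOne (b : ℝ) {s : ℝ≥0} (hs : s ≠ 0) :
    (gaussianReal 0 s).map (fun x => (x + b) ^ 2 * (s : ℝ)⁻¹) = chiSqOne (b ^ 2 / s) := by
  have hs' : (0 : ℝ) < s := lt_of_le_of_ne s.2 (fun h => hs (NNReal.coe_eq_zero.1 h.symm))
  have h1 : (gaussianReal 0 s).map (fun x => (x + b) / √s) = gaussianReal (b / √s) 1 := by
    have h2 := gaussianReal_map_add_const (μ := 0) (v := s) b
    have h3 := gaussianReal_map_div_const (μ := 0 + b) (v := s) (√s)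
    rw [← h2, Measure.map_map (by fun_prop) (by fun_prop)] at h3
    have h4 : s / (.mk (√s ^ 2) (sq_nonneg _) : ℝ≥0) = 1 := by
      apply NNReal.coe_injective
      rw [NNReal.coe_div]
      simp [Real.sq_sqrt hs'.le, hs]
    rw [zero_add, h4] at h3
    exact h3
  have h5 : (fun x : ℝ => (x + b) ^ 2 * (s : ℝ)⁻¹) = (fun x => x ^ 2) ∘ fun x => (x + b) / √s := by
    ext x
    simp only [Function.comp]
    rw [div_pow, Real.sq_sqrt hs'.le, div_eq_mul_inv]
  rw [h5, ← Measure.map_map (by fun_prop) (by fun_prop), h1, chiSqOne, Real.sqrt_div (sq_nonneg b),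
    Real.sqrt_sq_eq_abs]
  -- `χ²(δ, 1)` is defined by the nonnegative mean `√δ`; a negative mean is reflected.
  rcases abs_choice b with h | h
  · rw [h]
  · rw [h, neg_div, ← gaussianReal_map_neg, Measure.map_map (by fun_prop) (by fun_prop)]
    congr 1
    ext x
    simp

/-- The sample mean of `g` over the first `N` observations. -/
noncomputable def sampleMean {E : Type*} (g : E → ℝ) (N : ℕ) (ω : ℕ → E) : ℝ :=
  (N : ℝ)⁻¹ * ∑ i ∈ Finset.range N, g (ω i)

/-- The statistic `N (w'm)² / (w'V̂w)`, as a function of the contributions `g (ω i)` of the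
individuals to `w'm`. -/
noncomputable def arRatio {E : Type*} (centered : Bool) (g : E → ℝ) (N : ℕ) (ω : ℕ → E) : ℝ :=
  N * sampleMean g N ω ^ 2 /
    sampleMean (fun x => (g x - if centered then sampleMean g N ω else 0) ^ 2) N ω

/-- The contribution of one individual when the hypothesized value is `1 - a`. -/
def localContribution {E : Type*} (f₀ f₁ f₂ : E → ℝ) (a : ℝ) (x : E) : ℝ :=
  (1 - a) ^ 2 * f₀ x + (1 - a) * a * f₁ x + a ^ 2 * f₂ x

lemma sampleMean_localContribution {E : Type*} (f₀ f₁ f₂ : E → ℝ) (a : ℝ) (N : ℕ) (ω : ℕ → E) :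
    sampleMean (localContribution f₀ f₁ f₂ a) N ω = (1 - a) ^ 2 * sampleMean f₀ N ω +
      (1 - a) * a * sampleMean f₁ N ω + a ^ 2 * sampleMean f₂ N ω := by
  simp only [sampleMean, localContribution, Finset.sum_add_distrib, ← Finset.mul_sum]
  ring

lemma sampleMean_localContribution_sq {E : Type*} (f₀ f₁ f₂ : E → ℝ) (a : ℝ) (N : ℕ) (ω : ℕ → E) :
    sampleMean (fun x => localContribution f₀ f₁ f₂ a x ^ 2) N ω =
      (1 - a) ^ 4 * sampleMean (fun x => f₀ x * f₀ x) N ω +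
      (1 - a) ^ 2 * a ^ 2 * sampleMean (fun x => f₁ x * f₁ x) N ω +
      a ^ 4 * sampleMean (fun x => f₂ x * f₂ x) N ω +
      2 * (1 - a) ^ 3 * a * sampleMean (fun x => f₀ x * f₁ x) N ω +
      2 * (1 - a) ^ 2 * a ^ 2 * sampleMean (fun x => f₀ x * f₂ x) N ω +
      2 * (1 - a) * a ^ 3 * sampleMean (fun x => f₁ x * f₂ x) N ω := by
  simp only [sampleMean]
  rw [← sub_eq_zero]
  have : ∀ x, localContribution f₀ f₁ f₂ a x ^ 2 =
      (1 - a) ^ 4 * (f₀ x * f₀ x) + (1 - a) ^ 2 * a ^ 2 * (f₁ x * f₁ x) + a ^ 4 * (f₂ x * f₂ x) +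
      2 * (1 - a) ^ 3 * a * (f₀ x * f₁ x) + 2 * (1 - a) ^ 2 * a ^ 2 * (f₀ x * f₂ x) +
      2 * (1 - a) * a ^ 3 * (f₁ x * f₂ x) := by
    intro x
    simp only [localContribution]
    ring
  simp only [this, Finset.sum_add_distrib, ← Finset.mul_sum]
  ring

/-- The centered second moment is `mean of squares - square of the mean`, also for `N = 0`. -/
lemma sampleMean_sub_sq {E : Type*} (centered : Bool) (g : E → ℝ) (N : ℕ) (ω : ℕ → E) :
    sampleMean (fun x => (g x - if centered then sampleMean g N ω else 0) ^ 2) N ω =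
      sampleMean (fun x => g x ^ 2) N ω - (if centered then sampleMean g N ω ^ 2 else 0) := by
  cases centered
  · simp
  · rcases Nat.eq_zero_or_pos N with rfl | hN
    · simp [sampleMean]
    · have hN' : (N : ℝ) ≠ 0 := by exact_mod_cast hN.ne'
      have h : ∀ c : ℝ, ∑ i ∈ Finset.range N, (g (ω i) - c) ^ 2 =
          ∑ i ∈ Finset.range N, g (ω i) ^ 2 - 2 * c * ∑ i ∈ Finset.range N, g (ω i) +
            N * c ^ 2 := by
        intro c
        simp only [sub_sq, Finset.sum_add_distrib, Finset.sum_sub_distrib, Finset.sum_const,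
          Finset.card_range, nsmul_eq_mul, Finset.mul_sum]
        congr 2
        exact Finset.sum_congr rfl fun i _ => by ring
      simp only [if_true, sampleMean, h]
      field_simp
      ring

variable {E : Type*} [MeasurableSpace E] {ν : Measure E} [IsProbabilityMeasure ν]

/-- The law of an i.i.d. sequence with common law `ν`. -/
noncomputable abbrev iidLaw (ν : Measure E) [IsProbabilityMeasure ν] : Measure (ℕ → E) :=
  Measure.infinitePi fun _ => ν

lemma iIndepFun_eval {g : E → ℝ} (hg : Measurable g) :
    iIndepFun (fun (i : ℕ) (ω : ℕ → E) => g (ω i)) (iidLaw ν) :=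
  iIndepFun_infinitePi (P := fun _ : ℕ => ν) (X := fun _ => g) fun _ => hg

lemma identDistrib_eval {g : E → ℝ} (hg : Measurable g) (i j : ℕ) :
    IdentDistrib (fun ω : ℕ → E => g (ω i)) (fun ω => g (ω j)) (iidLaw ν) (iidLaw ν) := by
  have h : ∀ i : ℕ, (iidLaw ν).map (fun ω => ω i) = ν := fun i =>
    Measure.infinitePi_map_eval (fun _ : ℕ => ν) i
  refine IdentDistrib.comp (f := fun ω : ℕ → E => ω i) (g := fun ω : ℕ → E => ω j) ⟨?_, ?_, ?_⟩ hg
  · exact (measurable_pi_apply i).aemeasurable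
  · exact (measurable_pi_apply j).aemeasurable
  · rw [h, h]

lemma integral_eval_iidLaw {g : E → ℝ} (hg : AEStronglyMeasurable g ν) (i : ℕ) :
    ∫ ω, g (ω i) ∂iidLaw ν = ∫ x, g x ∂ν := by
  have h := Measure.infinitePi_map_eval (fun _ : ℕ => ν) i
  have h2 := integral_map (μ := iidLaw ν) (f := g) (measurable_pi_apply i).aemeasurable
    (by rw [h]; exact hg)
  rw [h] at h2
  exact h2.symm

lemma memLp_eval_iidLaw {g : E → ℝ} {p : ENNReal} (hg : MemLp g p ν) (i : ℕ) :
    MemLp (fun ω : ℕ → E => g (ω i)) p (iidLaw ν) :=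
  hg.comp_measurePreserving (measurePreserving_eval_infinitePi (fun _ : ℕ => ν) i)

lemma measurable_sampleMean {g : E → ℝ} (hg : Measurable g) (N : ℕ) :
    Measurable (sampleMean g N) := by
  unfold sampleMean
  fun_prop

lemma tendsto_sampleMean {g : E → ℝ} (hg : Measurable g) (hi : Integrable g ν) :
    ∀ᵐ ω ∂iidLaw ν, Tendsto (fun N => sampleMean g N ω) atTop (𝓝 (∫ x, g x ∂ν)) := by
  have h := strong_law_ae_real (μ := iidLaw ν) (fun (i : ℕ) (ω : ℕ → E) => g (ω i))
    (memLp_one_iff_integrable.1 (memLp_eval_iidLaw (memLp_one_iff_integrable.2 hi) 0))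
    (fun i j hij => (iIndepFun_eval hg).indepFun hij) (fun i => identDistrib_eval hg i 0)
  rw [integral_eval_iidLaw hi.1] at h
  filter_upwards [h] with ω hω
  simpa only [sampleMean, div_eq_inv_mul] using hω

lemma tendstoInDistribution_sqrt_mul_sampleMean {g : E → ℝ} (hg : Measurable g) (hL : MemLp g 2 ν)
    (h0 : ∫ x, g x ∂ν = 0) :
    TendstoInDistribution (fun (N : ℕ) ω => √N * sampleMean g N ω) atTop (id : ℝ → ℝ)
      (fun _ => iidLaw ν) (gaussianReal 0 (∫ x, g x ^ 2 ∂ν).toNNReal) := by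
  have hv : Var[fun ω : ℕ → E => g (ω 0); iidLaw ν] = ∫ x, g x ^ 2 ∂ν := by
    rw [variance_of_integral_eq_zero, integral_eval_iidLaw (g := fun x => g x ^ 2)]
    · fun_prop
    · exact (hg.comp (measurable_pi_apply 0)).aemeasurable
    · rw [integral_eval_iidLaw hL.1, h0]
  have h := tendstoInDistribution_inv_sqrt_mul_sum_sub (P := iidLaw ν)
    (X := fun (i : ℕ) (ω : ℕ → E) => g (ω i))
    (P' := gaussianReal 0 (∫ x, g x ^ 2 ∂ν).toNNReal) (Y := id)
    (by rw [hv]; exact HasLaw.id) (memLp_eval_iidLaw hL 0) (iIndepFun_eval hg)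
    (fun i => identDistrib_eval hg i 0)
  rw [integral_eval_iidLaw hL.1, h0] at h
  convert h using 3 with N ω
  rw [sampleMean, mul_zero, sub_zero, ← mul_assoc]
  congr 1
  rcases Nat.eq_zero_or_pos N with rfl | hN
  · simp
  · have : (0 : ℝ) < N := by exact_mod_cast hN
    field_simp
    rw [Real.sq_sqrt this.le]

/-- By Chebyshev's inequality, a null sequence kills a centered and normalized sum. -/
lemma tendstoInMeasure_mul_sqrt_mul_sampleMean {g : E → ℝ} (hg : Measurable g) (hL : MemLp g 2 ν)
    (h0 : ∫ x, g x ∂ν = 0) {b : ℕ → ℝ} (hb : Tendsto b atTop (𝓝 0)) :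
    TendstoInMeasure (iidLaw ν) (fun (N : ℕ) ω => b N * (√N * sampleMean g N ω)) atTop
      (fun _ => 0) := by
  set C : ℝ := ∫ x, g x ^ 2 ∂ν with hC
  have hC0 : 0 ≤ C := integral_nonneg fun x => sq_nonneg _
  have hm := fun i : ℕ => memLp_eval_iidLaw (ν := ν) hL i
  have hv : ∀ i : ℕ, Var[fun ω : ℕ → E => g (ω i); iidLaw ν] = C := by
    intro i
    rw [variance_of_integral_eq_zero, integral_eval_iidLaw (g := fun x => g x ^ 2)]
    · fun_prop
    · exact (hg.comp (measurable_pi_apply i)).aemeasurable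
    · rw [integral_eval_iidLaw hL.1, h0]
  have hform : ∀ N : ℕ, (fun ω : ℕ → E => b N * (√N * sampleMean g N ω)) =
      fun ω => (b N * √N * (N : ℝ)⁻¹) * (∑ i ∈ Finset.range N, fun ω : ℕ → E => g (ω i)) ω := by
    intro N
    ext ω
    simp only [sampleMean, Finset.sum_apply]
    ring
  have hmem : ∀ N : ℕ, MemLp (fun ω : ℕ → E => b N * (√N * sampleMean g N ω)) 2 (iidLaw ν) := by
    intro N
    rw [hform]
    exact (memLp_finsetSum' _ fun i _ => hm i).const_mul _
  have hmean : ∀ N : ℕ, ∫ ω, b N * (√N * sampleMean g N ω) ∂iidLaw ν = 0 := by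
    intro N
    simp only [sampleMean]
    rw [integral_const_mul, integral_const_mul, integral_const_mul,
      integral_finsetSum _ fun i _ => (hm i).integrable (by norm_num)]
    simp [integral_eval_iidLaw hL.1, h0]
  have hvar : ∀ N : ℕ, Var[fun ω : ℕ → E => b N * (√N * sampleMean g N ω); iidLaw ν] ≤
      b N ^ 2 * C := by
    intro N
    rw [hform, variance_const_mul, IndepFun.variance_sum (fun i _ => hm i)
      (fun i _ j _ hij => (iIndepFun_eval hg).indepFun hij)]
    simp only [hv, Finset.sum_const, Finset.card_range, nsmul_eq_mul]
    rcases Nat.eq_zero_or_pos N with rfl | hN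
    · simp only [Nat.cast_zero, zero_mul, mul_zero]
      positivity
    · have hN' : (0 : ℝ) < N := by exact_mod_cast hN
      rw [mul_pow, mul_pow, Real.sq_sqrt hN'.le]
      apply le_of_eq
      field_simp
  rw [tendstoInMeasure_iff_measureReal_norm]
  intro ε hε
  refine squeeze_zero (fun _ => measureReal_nonneg) (fun N => ?_)
    (g := fun N => b N ^ 2 * C / ε ^ 2) ?_
  · have h := meas_ge_le_variance_div_sq (hmem N) hε
    rw [hmean] at h
    have h2 := ENNReal.toReal_mono ENNReal.ofReal_ne_top h
    rw [ENNReal.toReal_ofReal (div_nonneg (variance_nonneg _ _) (sq_nonneg _))] at h2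
    refine h2.trans ?_
    gcongr
    exact hvar N
  · have := ((hb.pow 2).mul_const C).div_const (ε ^ 2)
    simpa using this

variable {f₀ f₁ f₂ : E → ℝ} {a : ℕ → ℝ}

/-- The limit law of the statistic in a neighbourhood of the true value: the leading term `f₀`
obeys the central limit theorem, the term linear in `a` is negligible, and the quadratic term, of
order `a² = O(N^{-1/2})`, contributes the noncentrality through its mean. -/
lemma tendstoInDistribution_arRatio (hf₀ : Measurable f₀) (hf₁ : Measurable f₁)
    (hf₂ : Measurable f₂) (h₀ : MemLp f₀ 2 ν) (h₁ : MemLp f₁ 2 ν) (h₂ : MemLp f₂ 2 ν)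
    (hm₀ : ∫ x, f₀ x ∂ν = 0) (hm₁ : ∫ x, f₁ x ∂ν = 0) (hs : 0 < ∫ x, f₀ x ^ 2 ∂ν)
    (ha : Tendsto a atTop (𝓝 0)) {κ : ℝ} (hκ : Tendsto (fun N : ℕ => √N * a N ^ 2) atTop (𝓝 κ))
    (centered : Bool) :
    TendstoInDistribution (fun N => arRatio centered (localContribution f₀ f₁ f₂ (a N)) N) atTop
      (id : ℝ → ℝ) (fun _ => iidLaw ν)
      (chiSqOne ((κ * ∫ x, f₂ x ∂ν) ^ 2 / ∫ x, f₀ x ^ 2 ∂ν)) := by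
  set s : ℝ := ∫ x, f₀ x ^ 2 ∂ν with hsdef
  set m : ℝ := ∫ x, f₂ x ∂ν with hmdef
  have hmeas : ∀ N, Measurable (localContribution f₀ f₁ f₂ (a N)) := fun N => by
    unfold localContribution
    fun_prop
  set S : ℕ → (ℕ → E) → ℝ := fun N ω => √N * sampleMean (localContribution f₀ f₁ f₂ (a N)) N ω
    with hS
  set V : ℕ → (ℕ → E) → ℝ := fun N ω =>
    sampleMean (fun x => localContribution f₀ f₁ f₂ (a N) x ^ 2) N ω -
      (if centered then sampleMean (localContribution f₀ f₁ f₂ (a N)) N ω ^ 2 else 0) with hV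
  have hSm : ∀ N, Measurable (S N) := fun N => (measurable_sampleMean (hmeas N) N).const_mul _
  have hVm : ∀ N, Measurable (V N) := fun N => by
    refine (measurable_sampleMean ((hmeas N).pow_const 2) N).sub ?_
    cases centered
    · exact measurable_const
    · exact (measurable_sampleMean (hmeas N) N).pow_const 2
  -- In the numerator `√N w'm`, only the mean of the quadratic term survives beside the central
  -- limit theorem: `√N (1 - a)² f₀` is `√N f₀` up to a null term,
  -- and the linear term is null.
  have hnum : TendstoInDistribution S atTop (fun x : ℝ => x + κ * m) (fun _ => iidLaw ν)
      (gaussianReal 0 s.toNNReal) := by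
    have hclt := tendstoInDistribution_sqrt_mul_sampleMean hf₀ h₀ hm₀
    have hb₀ : Tendsto (fun N => (1 - a N) ^ 2 - 1) atTop (𝓝 0) := by
      have := ((tendsto_const_nhds (x := (1 : ℝ))).sub ha).pow 2 |>.sub_const 1
      simpa using this
    have hb₁ : Tendsto (fun N => (1 - a N) * a N) atTop (𝓝 0) := by
      have := ((tendsto_const_nhds (x := (1 : ℝ))).sub ha).mul ha
      simpa using this
    have hr₀ := tendstoInMeasure_mul_sqrt_mul_sampleMean hf₀ h₀ hm₀ hb₀
    have hr₁ := tendstoInMeasure_mul_sqrt_mul_sampleMean hf₁ h₁ hm₁ hb₁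
    have hr₂ : TendstoInMeasure (iidLaw ν)
        (fun (N : ℕ) ω => (√N * a N ^ 2) * sampleMean f₂ N ω) atTop (fun _ => κ * m) := by
      refine tendstoInMeasure_of_tendsto_ae
        (fun N => ((measurable_sampleMean hf₂ N).const_mul _).aestronglyMeasurable) ?_
      filter_upwards [tendsto_sampleMean hf₂ (h₂.integrable (by norm_num))] with ω hω
      exact hκ.mul hω
    have := ((hclt.add_of_tendstoInMeasure_const hr₀ fun N =>
        ((measurable_sampleMean hf₀ N).const_mul _ |>.const_mul _).aemeasurable
      ).add_of_tendstoInMeasure_const hr₁ fun N =>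
        ((measurable_sampleMean hf₁ N).const_mul _ |>.const_mul _).aemeasurable
      ).add_of_tendstoInMeasure_const hr₂ fun N =>
        ((measurable_sampleMean hf₂ N).const_mul _).aemeasurable
    convert this using 1
    · ext N ω
      simp only [hS, sampleMean_localContribution, Pi.add_apply]
      ring
    · ext x
      simp
  -- The variance estimator converges almost surely to `s`, whether centered or not, as the mean
  -- tends to zero.
  have hden : TendstoInMeasure (iidLaw ν) (fun N ω => (V N ω)⁻¹) atTop (fun _ => s⁻¹) := by
    refine tendstoInMeasure_of_tendsto_ae (fun N => (hVm N).inv.aestronglyMeasurable) ?_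
    filter_upwards [tendsto_sampleMean hf₀ (h₀.integrable (by norm_num)),
      tendsto_sampleMean hf₁ (h₁.integrable (by norm_num)),
      tendsto_sampleMean hf₂ (h₂.integrable (by norm_num)),
      tendsto_sampleMean (hf₀.mul hf₀) (h₀.integrable_mul h₀),
      tendsto_sampleMean (hf₁.mul hf₁) (h₁.integrable_mul h₁),
      tendsto_sampleMean (hf₂.mul hf₂) (h₂.integrable_mul h₂),
      tendsto_sampleMean (hf₀.mul hf₁) (h₀.integrable_mul h₁),
      tendsto_sampleMean (hf₀.mul hf₂) (h₀.integrable_mul h₂),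
      tendsto_sampleMean (hf₁.mul hf₂) (h₁.integrable_mul h₂)]
      with ω t₀ t₁ t₂ t₀₀ t₁₁ t₂₂ t₀₁ t₀₂ t₁₂
    refine Tendsto.inv₀ ?_ hs.ne'
    have hr : Tendsto (fun N => 1 - a N) atTop (𝓝 1) := by
      simpa using (tendsto_const_nhds (x := (1 : ℝ))).sub ha
    have hmean : Tendsto (fun N => sampleMean (localContribution f₀ f₁ f₂ (a N)) N ω) atTop
        (𝓝 0) := by
      simp only [sampleMean_localContribution]
      have := (((hr.pow 2).mul t₀).add ((hr.mul ha).mul t₁)).add ((ha.pow 2).mul t₂)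
      simpa [hm₀] using this
    have hsq : Tendsto (fun N => sampleMean (fun x => localContribution f₀ f₁ f₂ (a N) x ^ 2) N ω)
        atTop (𝓝 s) := by
      simp only [sampleMean_localContribution_sq]
      have := ((((((hr.pow 4).mul t₀₀).add (((hr.pow 2).mul (ha.pow 2)).mul t₁₁)).add
        ((ha.pow 4).mul t₂₂)).add ((((hr.pow 3).const_mul 2).mul ha).mul t₀₁)).add
        ((((hr.pow 2).const_mul 2).mul (ha.pow 2)).mul t₀₂)).add
        (((hr.const_mul 2).mul (ha.pow 3)).mul t₁₂)
      convert! this using 2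
      simp [hsdef, sq]
    cases centered
    · simpa [hV] using hsq
    · simpa [hV] using hsq.sub (hmean.pow 2)
  have hfinal := hnum.continuous_comp_prodMk_of_tendstoInMeasure_const
    (g := fun p : ℝ × ℝ => p.1 ^ 2 * p.2) (by fun_prop) hden
    (fun N => (hVm N).inv.aemeasurable)
  have heq : ∀ N, arRatio centered (localContribution f₀ f₁ f₂ (a N)) N =
      fun ω => S N ω ^ 2 * (V N ω)⁻¹ := by
    intro N
    ext ω
    rw [arRatio, sampleMean_sub_sq, div_eq_mul_inv]
    simp only [hS, hV, mul_pow, Real.sq_sqrt (Nat.cast_nonneg N)]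
  have hs0 : s.toNNReal ≠ 0 := (Real.toNNReal_pos.2 hs).ne'
  have hlaw := map_gaussianReal_sq_eq_chiSqOne (κ * m) hs0
  rw [Real.coe_toNNReal _ hs.le] at hlaw
  refine tendstoInDistribution_congr_law (fun N => ?_) aemeasurable_id (fun N => ?_) ?_ hfinal
  · rw [heq]
    exact (((hSm N).pow_const 2).mul (hVm N).inv).aemeasurable
  · rw [heq]
  · rw [Measure.map_id, hlaw]

end Convergence

/-! ### Quantiles and monotonicity of the noncentral chi-squared distribution -/

section ChiSquared

lemma chiSqOne_singleton (δ q : ℝ) : chiSqOne δ {q} = 0 := by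
  have := nullSingletonClass_gaussianReal (μ := √δ) (v := 1) one_ne_zero
  rw [chiSqOne, Measure.map_apply (by fun_prop) (measurableSet_singleton q)]
  refine Set.Finite.measure_zero (Set.Finite.subset (Set.toFinite {√q, -√q}) ?_) _
  intro x hx
  have hx' : x ^ 2 = q := hx
  have h : √q = |x| := by rw [← hx', Real.sqrt_sq_eq_abs]
  rcases abs_choice x with h2 | h2
  · left
    rw [h, h2]
  · right
    rw [Set.mem_singleton_iff, h, h2, neg_neg]

/-- A law without atoms has a continuous distribution function, hence exact critical values. -/
lemma exists_quantile (μ : Measure ℝ) [IsProbabilityMeasure μ] (hμ : ∀ x, μ {x} = 0) {α : ℝ}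
    (h0 : 0 < α) (h1 : α < 1) : ∃ q, μ.real (Set.Ioi q) = α := by
  have hcont : Continuous (cdf μ) := by
    rw [continuous_iff_continuousAt]
    intro x
    rw [(monotone_cdf μ).continuousAt_iff_leftLim_eq_rightLim, StieltjesFunction.rightLim_eq]
    have h := (cdf μ).measure_singleton x
    rw [measure_cdf, hμ, eq_comm, ENNReal.ofReal_eq_zero] at h
    exact le_antisymm ((monotone_cdf μ).leftLim_le le_rfl) (by linarith)
  obtain ⟨q, hq⟩ := mem_range_of_exists_le_of_exists_ge hcont
    (((tendsto_cdf_atBot μ).eventually_lt_const (sub_pos.2 h1)).exists.imp fun _ h => h.le)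
    (((tendsto_cdf_atTop μ).eventually_const_lt (sub_lt_self 1 h0)).exists.imp fun _ h => h.le)
  refine ⟨q, ?_⟩
  rw [← Set.compl_Iic, probReal_compl_eq_one_sub measurableSet_Iic, ← cdf_eq_real, hq]
  ring

/-- The power at a fixed critical value, from the limit law of the statistic. -/
lemma tendsto_real_gt {Ω : ℕ → Type*} [∀ N, MeasurableSpace (Ω N)] {P : ∀ N, Measure (Ω N)}
    [∀ N, IsProbabilityMeasure (P N)] {X : ∀ N, Ω N → ℝ} {δ : ℝ}
    (h : TendstoInDistribution X atTop (id : ℝ → ℝ) P (chiSqOne δ)) (q : ℝ) :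
    Tendsto (fun N => (P N).real {ω | q < X N ω}) atTop (𝓝 ((chiSqOne δ).real (Set.Ioi q))) := by
  have h1 := ProbabilityMeasure.tendsto_measure_of_null_frontier_of_tendsto' h.tendsto
    (E := Set.Ioi q) (by
      simp only [ProbabilityMeasure.coe_mk, Measure.map_id, frontier_Ioi]
      exact chiSqOne_singleton δ q)
  simp only [ProbabilityMeasure.coe_mk, Measure.map_id] at h1
  have h2 := (ENNReal.tendsto_toReal (measure_ne_top _ _)).comp h1
  refine h2.congr fun N => ?_
  simp only [Function.comp, Measure.real]
  rw [Measure.map_apply_of_aemeasurable (h.forall_aemeasurable N) measurableSet_Ioi]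
  rfl

lemma continuous_gaussianPDFReal : Continuous (gaussianPDFReal 0 1) := by
  unfold gaussianPDFReal
  fun_prop

lemma gaussianReal_real_Icc (s : ℝ) {t : ℝ} (ht : 0 ≤ t) :
    (gaussianReal s 1).real (Set.Icc (-t) t) = ∫ x in (-t - s)..(t - s), gaussianPDFReal 0 1 x := by
  rw [Measure.real, gaussianReal_apply_eq_integral _ one_ne_zero, ENNReal.toReal_ofReal
    (integral_nonneg fun x => gaussianPDFReal_nonneg _ _ _), integral_Icc_eq_integral_Ioc,
    ← intervalIntegral.integral_of_le (by linarith),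
    ← intervalIntegral.integral_comp_sub_right (fun x => gaussianPDFReal 0 1 x) s]
  simp only [gaussianPDFReal_sub, zero_add]

/-- The normal mass of a symmetric interval decreases as the mean moves away from zero: its
derivative in `s` is `φ (t + s) - φ (t - s)`. -/
lemma antitoneOn_gaussianReal_real_Icc {t : ℝ} (ht : 0 ≤ t) :
    AntitoneOn (fun s => (gaussianReal s 1).real (Set.Icc (-t) t)) (Set.Ici 0) := by
  simp only [gaussianReal_real_Icc _ ht]
  set G : ℝ → ℝ := fun x => ∫ y in (0 : ℝ)..x, gaussianPDFReal 0 1 y with hG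
  have hint : ∀ a b : ℝ, IntervalIntegrable (gaussianPDFReal 0 1) volume a b := fun a b =>
    continuous_gaussianPDFReal.intervalIntegrable a b
  have hGd : ∀ x, HasDerivAt G (gaussianPDFReal 0 1 x) x := fun x =>
    intervalIntegral.integral_hasDerivAt_right (hint 0 x)
      (continuous_gaussianPDFReal.stronglyMeasurableAtFilter _ _)
      continuous_gaussianPDFReal.continuousAt
  have heq : (fun s => ∫ x in (-t - s)..(t - s), gaussianPDFReal 0 1 x) =
      fun s => G (t - s) - G (-t - s) := by
    ext s
    rw [hG, intervalIntegral.integral_interval_sub_left (hint _ _) (hint _ _)]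
  rw [heq]
  have hd : ∀ s, HasDerivAt (fun s => G (t - s) - G (-t - s))
      (gaussianPDFReal 0 1 (t - s) * -1 - gaussianPDFReal 0 1 (-t - s) * -1) s := by
    intro s
    have h1 : ∀ c : ℝ, HasDerivAt (fun s : ℝ => c - s) (-1) s := fun c => by
      simpa using (hasDerivAt_id s).const_sub c
    exact ((hGd (t - s)).comp s (h1 t)).sub ((hGd (-t - s)).comp s (h1 (-t)))
  refine antitoneOn_of_deriv_nonpos (convex_Ici 0)
    (fun s _ => (hd s).continuousAt.continuousWithinAt)
    (fun s _ => (hd s).differentiableAt.differentiableWithinAt) fun s hs => ?_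
  rw [(hd s).deriv]
  have hs' : 0 < s := by simpa using hs
  have : gaussianPDFReal 0 1 (-t - s) ≤ gaussianPDFReal 0 1 (t - s) := by
    unfold gaussianPDFReal
    refine mul_le_mul_of_nonneg_left (Real.exp_le_exp.2 ?_) (by positivity)
    gcongr 1
    nlinarith [mul_nonneg ht hs'.le]
  linarith

/-- The power of the test increases with the noncentrality parameter. -/
lemma chiSqOne_real_Ioi_mono {δ₁ δ₂ : ℝ} (h : δ₁ ≤ δ₂) (q : ℝ) :
    (chiSqOne δ₁).real (Set.Ioi q) ≤ (chiSqOne δ₂).real (Set.Ioi q) := by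
  have hmap : ∀ δ, (chiSqOne δ).real (Set.Ioi q) =
      (gaussianReal (√δ) 1).real ((fun x => x ^ 2) ⁻¹' Set.Ioi q) := fun δ => by
    rw [chiSqOne, map_measureReal_apply (by fun_prop) measurableSet_Ioi]
  -- A negative critical value is always exceeded.
  rcases lt_or_ge q 0 with hq | hq
  · have : ((fun x : ℝ => x ^ 2) ⁻¹' Set.Ioi q) = Set.univ := by
      ext x
      simpa using hq.trans_le (sq_nonneg x)
    simp [hmap, this]
  · have : ((fun x : ℝ => x ^ 2) ⁻¹' Set.Ioi q) = (Set.Icc (-√q) (√q))ᶜ := by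
      ext x
      simp only [Set.mem_preimage, Set.mem_Ioi, Set.mem_compl_iff, Set.mem_Icc, ← abs_le]
      rw [not_le, Real.sqrt_lt hq (abs_nonneg x), sq_abs]
    rw [hmap, hmap, this, probReal_compl_eq_one_sub measurableSet_Icc,
      probReal_compl_eq_one_sub measurableSet_Icc]
    have := antitoneOn_gaussianReal_real_Icc (Real.sqrt_nonneg q) (Real.sqrt_nonneg δ₁)
      (Real.sqrt_nonneg δ₂) (Real.sqrt_le_sqrt h)
    simp only at this
    linarith

end ChiSquared

/-! ### The limit law of the statistic -/

section Statistic

variable {n : ℕ}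

/-- The expansion around the unit root, from `D_{1-a} = (1 - a) D₁ + a I`. -/
lemma dotProduct_momentVec (w : MomIdx n → ℝ) (a : ℝ) (d : Fin n → ℝ) :
    w ⬝ᵥ momentVec (1 - a) d =
      localContribution (quadForm ((quasiDiff n 1)ᵀ * weightMat w * quasiDiff n 1))
        (quadForm ((quasiDiff n 1)ᵀ * weightMat w + weightMat w * quasiDiff n 1))
        (quadForm (weightMat w)) a d := by
  have hs : (quasiDiff n (1 - a) * Matrix.vecMulVec d d * (quasiDiff n (1 - a))ᵀ).IsSymm := by
    simp only [IsSymm, transpose_mul, transpose_transpose, transpose_vecMulVec, Matrix.mul_assoc]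
  have hq : ∀ B : Matrix (Fin n) (Fin n) ℝ, trace (B * Matrix.vecMulVec d d) = quadForm B d := by
    intro B
    rw [mul_vecMulVec, trace_vecMulVec, quadForm, dotProduct_comm]
  rw [momentVec, dotProduct_selP_vech w hs, ← Matrix.mul_assoc, ← Matrix.mul_assoc,
    trace_mul_comm, ← Matrix.mul_assoc, ← Matrix.mul_assoc, hq, localContribution, quasiDiff_eq]
  simp only [quadForm]
  have hD : ((1 - a) • quasiDiff n 1 + (1 - (1 - a)) • (1 : Matrix (Fin n) (Fin n) ℝ))ᵀ *
      weightMat w * ((1 - a) • quasiDiff n 1 + (1 - (1 - a)) • (1 : Matrix (Fin n) (Fin n) ℝ)) =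
      (1 - a) ^ 2 • ((quasiDiff n 1)ᵀ * weightMat w * quasiDiff n 1) +
      ((1 - a) * a) • ((quasiDiff n 1)ᵀ * weightMat w + weightMat w * quasiDiff n 1) +
      a ^ 2 • weightMat w := by
    simp only [transpose_add, transpose_smul, transpose_one, Matrix.add_mul, Matrix.mul_add,
      Matrix.smul_mul, Matrix.mul_smul, Matrix.one_mul, Matrix.mul_one, sub_sub_cancel]
    module
  rw [hD]
  simp only [add_mulVec, smul_mulVec, dotProduct_add, dotProduct_smul, smul_eq_mul]

/-- The statistic depends on the individuals only through the scalars `w' mᵢ(r)`. -/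
lemma gmmAR_eq {N : ℕ} (centered : Bool) (w : MomIdx n → ℝ) (r : ℝ) (d : Fin N → Fin n → ℝ) :
    gmmAR centered w r d =
      N * ((N : ℝ)⁻¹ * ∑ i, w ⬝ᵥ momentVec r (d i)) ^ 2 /
        ((N : ℝ)⁻¹ * ∑ i, (w ⬝ᵥ momentVec r (d i) -
          if centered then (N : ℝ)⁻¹ * ∑ j, w ⬝ᵥ momentVec r (d j) else 0) ^ 2) := by
  have h1 : w ⬝ᵥ sampleMoment r d = (N : ℝ)⁻¹ * ∑ i, w ⬝ᵥ momentVec r (d i) := by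
    rw [sampleMoment, dotProduct_smul, dotProduct_sum, smul_eq_mul]
  have h2 : ∀ x : MomIdx n → ℝ, w ⬝ᵥ (Matrix.vecMulVec x x *ᵥ w) = (w ⬝ᵥ x) ^ 2 := by
    intro x
    rw [vecMulVec_mulVec, dotProduct_comm x w, sq]
    simp
  have h3 : w ⬝ᵥ (if centered then sampleMoment r d else 0) =
      if centered then (N : ℝ)⁻¹ * ∑ j, w ⬝ᵥ momentVec r (d j) else 0 := by
    split_ifs
    · exact h1
    · exact dotProduct_zero w
  rw [gmmAR, h1, eickerWhite]
  simp only [smul_mulVec, dotProduct_smul, sum_mulVec, dotProduct_sum, h2, dotProduct_sub, h3,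
    smul_eq_mul]

/-- The statistic as a ratio of sample means of the first `N` terms of a sequence. -/
lemma gmmAR_eq_arRatio {N : ℕ} (centered : Bool) (w : MomIdx n → ℝ) (r : ℝ) (ω : ℕ → Fin n → ℝ) :
    gmmAR centered w r (fun i : Fin N => ω i) =
      arRatio centered (fun d => w ⬝ᵥ momentVec r d) N ω := by
  rw [gmmAR_eq, arRatio, sampleMean, sampleMean,
    Fin.sum_univ_eq_sum_range (fun i => w ⬝ᵥ momentVec r (ω i)),
    Fin.sum_univ_eq_sum_range (fun i => (w ⬝ᵥ momentVec r (ω i) -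
      if centered then (N : ℝ)⁻¹ * ∑ j ∈ Finset.range N, w ⬝ᵥ momentVec r (ω j) else 0) ^ 2)]

lemma measurable_dotProduct_momentVec (w : MomIdx n → ℝ) (a : ℝ) :
    Measurable fun d : Fin n → ℝ => w ⬝ᵥ momentVec (1 - a) d := by
  simp only [dotProduct_momentVec, localContribution]
  exact (((measurable_quadForm _).const_mul _).add ((measurable_quadForm _).const_mul _)).add
    ((measurable_quadForm _).const_mul _)

lemma measurable_gmmAR (N : ℕ) (centered : Bool) (w : MomIdx n → ℝ) (a : ℝ) :
    Measurable fun d : Fin N → Fin n → ℝ => gmmAR centered w (1 - a) d := by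
  simp only [gmmAR_eq]
  have h : ∀ i : Fin N, Measurable fun d : Fin N → Fin n → ℝ => w ⬝ᵥ momentVec (1 - a) (d i) :=
    fun i => (measurable_dotProduct_momentVec w a).comp (measurable_pi_apply i)
  have hs : Measurable fun d : Fin N → Fin n → ℝ => ∑ i, w ⬝ᵥ momentVec (1 - a) (d i) :=
    Finset.measurable_sum _ fun i _ => h i
  refine Measurable.div (((hs.const_mul _).pow_const 2).const_mul _) (Measurable.const_mul ?_ _)
  refine Finset.measurable_sum _ fun i _ => ((h i).sub ?_).pow_const 2
  cases centered
  · exact measurable_const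
  · exact hs.const_mul _

variable (e : ℝ)

lemma tendsto_deviation : Tendsto (fun N : ℕ => e / (N : ℝ) ^ (1 / 4 : ℝ)) atTop (𝓝 0) :=
  ((tendsto_rpow_atTop (by norm_num)).comp tendsto_natCast_atTop_atTop).const_div_atTop e

lemma tendsto_sqrt_mul_deviation_sq :
    Tendsto (fun N : ℕ => √N * (e / (N : ℝ) ^ (1 / 4 : ℝ)) ^ 2) atTop (𝓝 (e ^ 2)) := by
  refine tendsto_const_nhds.congr' ?_
  filter_upwards [eventually_gt_atTop 0] with N hN
  have hN' : (0 : ℝ) < N := by exact_mod_cast hN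
  have h : ((N : ℝ) ^ (1 / 4 : ℝ)) ^ 2 = √N := by
    rw [← Real.rpow_natCast, ← Real.rpow_mul hN'.le, Real.sqrt_eq_rpow]
    norm_num
  have h2 : 0 < √(N : ℝ) := Real.sqrt_pos.2 hN'
  rw [div_pow, h]
  field_simp

/-- The limit law of the statistic for i.i.d. vectors of normal errors. -/
lemma tendstoInDistribution_gmmAR_iid (hn : 2 ≤ n) {v : ℝ≥0} (hv : v ≠ 0) (centered : Bool)
    {w : MomIdx n → ℝ} (hw : w ≠ 0) :
    TendstoInDistribution (fun (N : ℕ) (ω : ℕ → Fin n → ℝ) =>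
      gmmAR centered w (nullValue e N) (fun i : Fin N => ω i)) atTop (id : ℝ → ℝ)
      (fun _ => iidLaw (gaussVec n v)) (chiSqOne (noncentrality n e w)) := by
  set D := quasiDiff n 1 with hD
  set W := weightMat w with hW
  have hWs : W.IsSymm := weightMat_isSymm w
  have hv0 : (0 : ℝ) < v := lt_of_le_of_ne v.2 (fun h => hv (NNReal.coe_eq_zero.1 h.symm))
  have ht₀ : trace (Dᵀ * W * D) = 0 := by
    rw [Matrix.mul_assoc, trace_mul_comm, Matrix.mul_assoc]
    exact trace_weightMat_gramG hn w
  have ht₁ : trace (Dᵀ * W + W * D) = 0 := by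
    rw [trace_add, trace_mul_comm, ← trace_add, ← Matrix.mul_add, add_comm, quasiDiff_add_transpose,
      Matrix.mul_add, trace_add, trace_weightMat_gramG hn, trace_weightMat_firstProj hn, add_zero]
  have hsq : ∫ x, quadForm (Dᵀ * W * D) x ^ 2 ∂gaussVec n v =
      (v : ℝ) ^ 2 * (w ⬝ᵥ (momentCov n *ᵥ w)) := by
    rw [integral_quadForm_sq (by
      simp only [IsSymm, transpose_mul, transpose_transpose, hWs.eq, Matrix.mul_assoc]),
      momentCov_form_eq, ht₀]
    ring
  have hpos := momentCov_form_pos hw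
  have h := tendstoInDistribution_arRatio (ν := gaussVec n v)
    (measurable_quadForm (Dᵀ * W * D)) (measurable_quadForm (Dᵀ * W + W * D))
    (measurable_quadForm W) (memLp_quadForm _) (memLp_quadForm _) (memLp_quadForm _)
    (by rw [integral_quadForm, ht₀, mul_zero]) (by rw [integral_quadForm, ht₁, mul_zero])
    (by rw [hsq]; positivity) (tendsto_deviation e) (tendsto_sqrt_mul_deviation_sq e) centered
  rw [hsq, integral_quadForm] at h
  have hnc : (e ^ 2 * (v * trace W)) ^ 2 / ((v : ℝ) ^ 2 * (w ⬝ᵥ (momentCov n *ᵥ w))) =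
      noncentrality n e w := by
    rw [noncentrality_eq, dotProduct_drift hn, ← hW]
    field_simp
  rw [hnc] at h
  convert h using 3 with N ω
  rw [gmmAR_eq_arRatio]
  congr 1
  ext d
  exact dotProduct_momentVec w _ d

end Statistic

section Design

variable {T : ℕ} {σ : ℝ} {Ω : ℕ → Type*} [∀ N, MeasurableSpace (Ω N)] {P : ∀ N, Measure (Ω N)}
  {μ : ∀ N, Fin N → Ω N → ℝ} {ε y : ∀ N, Fin N → ℕ → Ω N → ℝ}

/-- With a unit root the differences are the errors, whatever the initial observation. -/
lemma WorstCaseDesign.firstDiff_eq (h : WorstCaseDesign T σ P μ ε y) (N : ℕ) (i : Fin N)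
    (ω : Ω N) (j : Fin (T - 1)) : firstDiff T (fun t => y N i t ω) j = ε N i (j.val + 2) ω := by
  have := h.model N i (j.val + 2) (by omega) (by omega) ω
  simp only [firstDiff, this, show j.val + 2 - 1 = j.val + 1 by omega]
  ring

lemma WorstCaseDesign.hasLaw_firstDiff (h : WorstCaseDesign T σ P μ ε y) (N : ℕ) (i : Fin N) :
    HasLaw (fun ω => firstDiff T (fun t => y N i t ω)) (gaussVec (T - 1) (Real.toNNReal (σ ^ 2)))
      (P N) := by
  have h1 : iIndepFun (fun (j : Fin (T - 1)) ω => ε N i (j.val + 2) ω) (P N) :=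
    (h.errors_indep N).precomp (g := fun j : Fin (T - 1) => (i, j)) fun j k hjk => by
      simpa using hjk
  have h2 := iIndepFun.hasLaw_pi
    (fun j : Fin (T - 1) => h.errors_law N i (j.val + 2) (by omega) (by omega)) h1
  convert h2 using 1
  ext ω j
  exact h.firstDiff_eq N i ω j

lemma WorstCaseDesign.hasLaw_data (h : WorstCaseDesign T σ P μ ε y) (N : ℕ) :
    HasLaw (fun ω (i : Fin N) => firstDiff T (fun t => y N i t ω))
      (Measure.pi fun _ => gaussVec (T - 1) (Real.toNNReal (σ ^ 2))) (P N) := by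
  refine iIndepFun.hasLaw_pi (fun i => h.hasLaw_firstDiff N i) ?_
  exact (h.indep N).comp (fun _ z (j : Fin (T - 1)) =>
    z ⟨j.val + 1, by omega⟩ - z ⟨j.val, by omega⟩) fun _ => by fun_prop

lemma map_restrict_iidLaw {E : Type*} [MeasurableSpace E] (ν : Measure E) [IsProbabilityMeasure ν]
    (N : ℕ) : (iidLaw ν).map (fun ω (i : Fin N) => ω i) = Measure.pi fun _ => ν := by
  have := Measure.map_infinitePi_infinitePi_of_inj (P := fun _ : ℕ => ν)
    (Fin.val_injective (n := N))
  rw [Measure.infinitePi_eq_pi (μ := fun _ : Fin N => ν)] at this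
  exact this

variable [∀ N, IsProbabilityMeasure (P N)]

lemma WorstCaseDesign.tendstoInDistribution_gmmAR (h : WorstCaseDesign T σ P μ ε y) (hT : 3 ≤ T)
    (e : ℝ) (centered : Bool) {w : MomIdx (T - 1) → ℝ} (hw : w ≠ 0) :
    TendstoInDistribution (fun N ω => gmmAR centered w (nullValue e N)
        (fun i : Fin N => firstDiff T (fun t => y N i t ω))) atTop (id : ℝ → ℝ) P
      (chiSqOne (noncentrality (T - 1) e w)) := by
  have hσ : Real.toNNReal (σ ^ 2) ≠ 0 := (Real.toNNReal_pos.2 (pow_pos h.sigma_pos 2)).ne'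
  refine tendstoInDistribution_congr_law (fun N => ?_) aemeasurable_id (fun N => ?_) rfl
    (tendstoInDistribution_gmmAR_iid e (by omega) hσ centered hw)
  · exact (measurable_gmmAR N centered w _).comp_aemeasurable (h.hasLaw_data N).aemeasurable
  · have h1 := AEMeasurable.map_map_of_aemeasurable (μ := P N)
      (measurable_gmmAR N centered w (e / (N : ℝ) ^ (1 / 4 : ℝ))).aemeasurable
      (h.hasLaw_data N).aemeasurable
    have h2 := Measure.map_map (μ := iidLaw (gaussVec (T - 1) (Real.toNNReal (σ ^ 2))))
      (measurable_gmmAR N centered w (e / (N : ℝ) ^ (1 / 4 : ℝ)))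
      (f := fun ω (i : Fin N) => ω i) (by fun_prop)
    rw [map_restrict_iidLaw] at h2
    rw [(h.hasLaw_data N).map_eq, h2] at h1
    exact h1.symm

end Design

end PanelAR

theorem theorem8 (T : ℕ) (hT : 3 ≤ T) (e σ : ℝ)
    {Ω : ℕ → Type*} [∀ N, MeasurableSpace (Ω N)] (P : ∀ N, Measure (Ω N))
    [∀ N, IsProbabilityMeasure (P N)] (μ : ∀ N, Fin N → Ω N → ℝ)
    (ε y : ∀ N, Fin N → ℕ → Ω N → ℝ) (h : PanelAR.WorstCaseDesign T σ P μ ε y)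
    (centered : Bool) :
    let n : ℕ := T - 1
    let R := PanelAR.momentCov n
    let c := PanelAR.drift n e
    let δ : ℝ := e ^ 4 * ((2 * (T : ℝ) - 3) * T * (T - 1) * (T - 2) / 72)
    let AR : (PanelAR.MomIdx n → ℝ) → ∀ N, Ω N → ℝ := fun w N ω =>
      PanelAR.gmmAR centered w (PanelAR.nullValue e N)
        (fun i : Fin N => PanelAR.firstDiff T (fun t => y N i t ω))
    -- every single linear combination gives a limiting noncentral chi-squared distribution
    (∀ w : PanelAR.MomIdx n → ℝ, w ≠ 0 →
      0 < w ⬝ᵥ (R *ᵥ w) ∧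
      TendstoInDistribution (AR w) atTop (id : ℝ → ℝ) P
        (PanelAR.chiSqOne (PanelAR.noncentrality n e w))) ∧
    -- `δ` is the largest root of the generalized eigenvalue problem
    IsGreatest {l : ℝ | (l • R - Matrix.vecMulVec c c).det = 0} δ ∧
    -- `δ` is the maximal noncentrality, attained exactly by the corresponding eigenvectors
    IsGreatest {l : ℝ | ∃ w : PanelAR.MomIdx n → ℝ, w ⬝ᵥ w = 1 ∧
      PanelAR.noncentrality n e w = l} δ ∧
    (∀ w : PanelAR.MomIdx n → ℝ, w ≠ 0 →
      (PanelAR.noncentrality n e w = δ ↔ Matrix.vecMulVec c c *ᵥ w = δ • (R *ᵥ w))) ∧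
    -- the maximal attainable asymptotic power at every level is that of `χ²(δ, 1)`
    (∀ α : ℝ, 0 < α → α < 1 →
      ∃ q : ℝ, (PanelAR.chiSqOne 0).real (Set.Ioi q) = α ∧
        IsGreatest {β : ℝ | ∃ w : PanelAR.MomIdx n → ℝ, w ⬝ᵥ w = 1 ∧
            Tendsto (fun N => (P N).real {ω | q < AR w N ω}) atTop (𝓝 β)}
          ((PanelAR.chiSqOne δ).real (Set.Ioi q)) ∧
        ∀ w : PanelAR.MomIdx n → ℝ, w ≠ 0 →
          Matrix.vecMulVec c c *ᵥ w = δ • (R *ᵥ w) →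
          Tendsto (fun N => (P N).real {ω | q < AR w N ω}) atTop
            (𝓝 ((PanelAR.chiSqOne δ).real (Set.Ioi q)))) := by
  intro n R c δ AR
  have hn : 2 ≤ n := by omega
  have hR : R.IsSymm := PanelAR.momentCov_isSymm n
  have hpos : ∀ x : PanelAR.MomIdx n → ℝ, x ≠ 0 → 0 < x ⬝ᵥ (R *ᵥ x) :=
    fun x hx => PanelAR.momentCov_form_pos hx
  obtain ⟨u, hu, hc, hδ, hueig⟩ := PanelAR.exists_drift_eq hn e
  set v := e ^ 2 • u with hv
  -- The subtraction in `n = T - 1` does not truncate, as `3 ≤ T`.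
  have hnT : (n : ℝ) = T - 1 := by
    rw [Nat.cast_sub (by omega : 1 ≤ T), Nat.cast_one]
  have hδn : e ^ 4 * ((2 * (n : ℝ) - 1) * (n + 1) * n * (n - 1) / 72) = δ := by
    simp only [δ, hnT]
    ring
  rw [hδn] at hδ hueig
  change c = R *ᵥ v at hc
  change v ⬝ᵥ (R *ᵥ v) = δ at hδ
  change vecMulVec c c *ᵥ u = δ • (R *ᵥ u) at hueig
  have hnc : ∀ w, PanelAR.noncentrality n e w = (w ⬝ᵥ c) ^ 2 / (w ⬝ᵥ (R *ᵥ w)) :=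
    fun w => PanelAR.noncentrality_eq e w
  have hiff : ∀ w : PanelAR.MomIdx n → ℝ, w ≠ 0 →
      (PanelAR.noncentrality n e w = δ ↔ vecMulVec c c *ᵥ w = δ • (R *ᵥ w)) := by
    intro w hw
    rw [hnc, hc, ← hδ]
    exact PanelAR.rayleigh_eq_iff hR hpos hw
  have hle : ∀ w : PanelAR.MomIdx n → ℝ, w ≠ 0 → PanelAR.noncentrality n e w ≤ δ := by
    intro w hw
    rw [hnc, hc, ← hδ, div_le_iff₀ (hpos w hw)]
    exact PanelAR.sq_dotProduct_le hR hpos w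
  have hne : ∀ w : PanelAR.MomIdx n → ℝ, w ⬝ᵥ w = 1 → w ≠ 0 := by
    rintro w hw rfl
    simp at hw
  have hlim : ∀ w : PanelAR.MomIdx n → ℝ, w ≠ 0 → TendstoInDistribution (AR w) atTop
      (id : ℝ → ℝ) P (PanelAR.chiSqOne (PanelAR.noncentrality n e w)) :=
    fun w hw => h.tendstoInDistribution_gmmAR hT e centered hw
  obtain ⟨w₀, hw₀, hw₀δ⟩ : ∃ w₀ : PanelAR.MomIdx n → ℝ, w₀ ⬝ᵥ w₀ = 1 ∧
      PanelAR.noncentrality n e w₀ = δ := by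
    have huu : 0 < u ⬝ᵥ u := by
      simpa using dotProduct_star_self_pos_iff.2 hu
    have hsq : √(u ⬝ᵥ u) ≠ 0 := (Real.sqrt_pos.2 huu).ne'
    refine ⟨(√(u ⬝ᵥ u))⁻¹ • u, ?_, ?_⟩
    · rw [smul_dotProduct, dotProduct_smul, smul_eq_mul, smul_eq_mul, ← mul_assoc, ← mul_inv,
        Real.mul_self_sqrt huu.le, inv_mul_cancel₀ huu.ne']
    · rw [PanelAR.noncentrality_smul e u (inv_ne_zero hsq)]
      exact (hiff u hu).2 hueig
  refine ⟨fun w hw => ⟨hpos w hw, hlim w hw⟩, ?_, ⟨⟨w₀, hw₀, hw₀δ⟩, ?_⟩, hiff, ?_⟩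
  · rw [hc, hδ.symm]
    rw [hc, hδ.symm] at hueig
    exact PanelAR.isGreatest_generalized_eigenvalue hR hpos hu hueig
  · rintro _ ⟨w, hw, rfl⟩
    exact hle w (hne w hw)
  · intro α hα0 hα1
    obtain ⟨q, hq⟩ := PanelAR.exists_quantile (PanelAR.chiSqOne 0) (PanelAR.chiSqOne_singleton 0)
      hα0 hα1
    refine ⟨q, hq, ⟨⟨w₀, hw₀, ?_⟩, ?_⟩, fun w hw hweig => ?_⟩
    · rw [← hw₀δ]
      exact PanelAR.tendsto_real_gt (hlim w₀ (hne w₀ hw₀)) q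
    · rintro β ⟨w, hw, hβ⟩
      rw [tendsto_nhds_unique hβ (PanelAR.tendsto_real_gt (hlim w (hne w hw)) q)]
      exact PanelAR.chiSqOne_real_Ioi_mono (hle w (hne w hw)) q
    · rw [← (hiff w hw).2 hweig]
      exact PanelAR.tendsto_real_gt (hlim w hw) q
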